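/- Let $p>1$. For every measurable function $f:[1,\infty)\to[0,\infty)$, $$\sum_{n=1}^{\infty}\left(\frac1n\int_1^n f(t)\,dt\right)^p\le\left(\frac{p}{p-1}\right)^p\int_1^{\infty}f(x)^p\,dx ,$$ where both sides take values in $[0,\infty]$. Let $1<p\le q<\infty$. Then there is a least constant $A\in[0,\infty)$ such that $$\left[\int_1^{\infty}\left(\frac1x\sum_{1\le n<x}f(n)\right)^q dx\right]^{1/q}\le A\left[\sum_{n=1}^{\infty}f(n)^p\right]^{1/p}$$ holds for every sequence $(f(n))_{n\ge1}$ of non-negative reals (both sides in $[0,\infty]$), and it satisfies $$(q-1)^{-1/q}\le A\le k_{q,p}\,(q-1)^{-1/q}.$$ Here, for $p<q$, with $r=q/p-1$ and $B(a,b)=\int_0^1x^{a-1}(1-x)^{b-1}\,dx$, $$k_{q,p}=\left(\frac{r}{B(1/r,(q-1)/r)}\right)^{1/p-1/q},$$ and for $p=q$, $k_{p,p}=p^{1/p}(p^*)^{1/p^*}$ with $p^*=p/(p-1)$. -/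

import Mathlib

open MeasureTheory Set
open scoped NNReal ENNReal

/-- Euler's beta function `B(a, b) = ∫₀¹ x ^ (a - 1) (1 - x) ^ (b - 1) dx`, used for `a, b > 0`. -/
noncomputable def eulerBeta (a b : ℝ) : ℝ :=
  ∫ x in (0 : ℝ)..1, x ^ (a - 1) * (1 - x) ^ (b - 1)

/-- The factor `k_{q,p} = (r / B(1/r, (q-1)/r)) ^ (1/p - 1/q)` with `r = q/p - 1` for `p < q`.
At `p = q` this expression is undefined, and `k_{p,p} = p ^ (1/p) * (p*) ^ (1/p*)`, where
`p* = p / (p - 1)`, is its limit as `q` decreases to `p`. -/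
noncomputable def hardyFactor (q p : ℝ) : ℝ :=
  if p = q then
    p ^ (1 / p) * (p / (p - 1)) ^ (1 - 1 / p)
  else
    ((q / p - 1) / eulerBeta (1 / (q / p - 1)) ((q - 1) / (q / p - 1))) ^ (1 / p - 1 / q)

/-- The constants `A ≥ 0` such that
`(∫₁^∞ ((1/x) ∑_{1 ≤ n < x} f n) ^ q dx) ^ (1/q) ≤ A (∑_{n ≥ 1} (f n) ^ p) ^ (1/p)` for every
non-negative sequence `f`, both sides being read in `[0, ∞]`.
For `n : ℕ`, `n < ⌈x⌉₊` is the same as `n < x`. -/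
def mixedHardyConstants (p q : ℝ) : Set ℝ≥0 :=
  {A | ∀ f : ℕ → ℝ≥0,
    (∫⁻ x in Ioi (1 : ℝ),
        ((ENNReal.ofReal x)⁻¹ * ∑ n ∈ Finset.Ico 1 ⌈x⌉₊, (f n : ℝ≥0∞)) ^ q) ^ (1 / q)
      ≤ (A : ℝ≥0∞) * (∑' n : ℕ, (f (n + 1) : ℝ≥0∞) ^ p) ^ (1 / p)}

/-! For the first inequality, let `a n` be the integral of `f` over the `n`-th unit interval.
Hardy's discrete inequality, proved by Elliott's telescoping argument (`hardy_step`), applies to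
`a`, and Hölder on each unit interval bounds `a n ^ p` by the integral of `f ^ p`.

In the second part the least constant is the infimum of the admissible ones. The sequence 1, 0, 0, …
gives the lower bound. For `p = q` the upper bound equals `p / (p - 1)` and follows from the
discrete inequality.

For `p < q` it follows from Bliss's inequality with sharp constant: if `F` is the primitive of `f ≥
0` with `F 0 = 0`, then `(q - r - 1) ∫ F ^ q x ^ (r - q) ≤ (r / B) ^ r (∫ f ^ p) ^ (q / p)`. An
extremal is `F = x (1 + x ^ r) ^ (-1 / r)`, for which `F ^ q x ^ (r - q)` and `f ^ p` are the
integrands of `blissH` and `blissJ`. The proof (`bliss_transport`) is by mass transport: let `T`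
carry the rescaled mass `F ^ q x ^ (r - q) dx` to the extremal one. The weighted
arithmetic-geometric mean and Young inequalities then make an explicit expression in `x`, `F` and
`T` nonincreasing, with nonpositive limiting bound at 0.

For a step function with values `a i`, the partial sum of length `n` is at most `F` on `[n, ∞)`.
With `c = q - r - 1`, Bliss's inequality thus bounds the `q`-th powers of the partial sums against
the weights `n ^ (-c) - (n + 1) ^ (-c)`. Integrating `x ^ (-q)` over `[n, n + 1]` gives `(n ^ (1 -
q) - (n + 1) ^ (1 - q)) / (q - 1)`. The tails `n ^ (1 - q)` are at most `n ^ (-c)`, and the partial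
sums increase, so summation by parts allows the change of weights. -/

/-! ### Hardy's discrete inequality -/

/-- One step of Elliott's proof of Hardy's inequality. -/
theorem hardy_step {p : ℝ} (hp : 1 < p) {x y a n : ℝ} (hx : 0 ≤ x) (hy : 0 ≤ y) (ha : 0 ≤ a)
    (hn : 0 ≤ n) (h : (n + 1) * y = n * x + a) :
    y ^ p + p / (p - 1) * ((n + 1) * y ^ p) ≤
      (p / (p - 1)) ^ p * a ^ p + p / (p - 1) * (n * x ^ p) := by
  have hp0 : 0 < p - 1 := by linarith
  have hpq : p.HolderConjugate (p / (p - 1)) := Real.HolderConjugate.conjExponent hp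
  have hyp : (y ^ (p - 1)) ^ (p / (p - 1)) = y ^ p := by
    rw [← Real.rpow_mul hy]; congr 1; field_simp
  have hy1 : y * y ^ (p - 1) = y ^ p := by
    have := Real.rpow_one_add' hy (y := p - 1) (by linarith)
    rw [← this, add_sub_cancel]
  have h1 := Real.young_inequality_of_nonneg hx (Real.rpow_nonneg hy (p - 1)) hpq
  -- Scaling `a` by the conjugate exponent yields the sharp constant termwise, so no Hölder step
  -- over the whole sum is needed.
  have h2 := Real.young_inequality_of_nonneg (a := p / (p - 1) * a) (b := y ^ (p - 1))
    (by positivity) (Real.rpow_nonneg hy (p - 1)) hpq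
  rw [hyp] at h1 h2
  rw [Real.mul_rpow (by positivity) ha] at h2
  set K := (p / (p - 1)) ^ p * a ^ p
  set U := x ^ p
  set V := y ^ p
  set D := y ^ (p - 1)
  have e : (n + 1) * V = n * (x * D) + a * D := by
    rw [← hy1]; linear_combination D * h
  have h1' : p * (x * D) ≤ U + (p - 1) * V := by
    have := mul_le_mul_of_nonneg_left h1 (show 0 ≤ p by linarith)
    refine this.trans_eq ?_
    field_simp
  have h2' : p ^ 2 * (a * D) ≤ (p - 1) * K + (p - 1) ^ 2 * V := by
    have := mul_le_mul_of_nonneg_left h2 (show 0 ≤ (p - 1) * p by positivity)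
    calc p ^ 2 * (a * D) = (p - 1) * p * (p / (p - 1) * a * D) := by field_simp
      _ ≤ _ := this
      _ = _ := by field_simp
  have key : (p - 1) * V + p * ((n + 1) * V) ≤ (p - 1) * K + p * (n * U) := by
    have h3 := mul_le_mul_of_nonneg_left h1' (show 0 ≤ n * p by positivity)
    linear_combination h3 + h2' + p ^ 2 * e
  rw [← mul_le_mul_iff_right₀ hp0]
  calc _ = (p - 1) * V + p * ((n + 1) * V) := by field_simp
    _ ≤ _ := key
    _ = _ := by field_simp

/-- Hardy's inequality for finite sums. -/
theorem hardy_finset {p : ℝ} (hp : 1 < p) (a : ℕ → ℝ≥0) (N : ℕ) :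
    ∑ n ∈ Finset.range N, ((n + 1 : ℝ)⁻¹ * ∑ k ∈ Finset.range (n + 1), (a k : ℝ)) ^ p ≤
      (p / (p - 1)) ^ p * ∑ n ∈ Finset.range N, (a n : ℝ) ^ p := by
  have hp0 : 0 < p - 1 := by linarith
  -- The added term is the potential that telescopes in `hardy_step`; it vanishes at `N = 0`.
  suffices h : ∑ n ∈ Finset.range N, ((n + 1 : ℝ)⁻¹ * ∑ k ∈ Finset.range (n + 1), (a k : ℝ)) ^ p
      + p / (p - 1) * (N * ((N : ℝ)⁻¹ * ∑ k ∈ Finset.range N, (a k : ℝ)) ^ p) ≤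
      (p / (p - 1)) ^ p * ∑ n ∈ Finset.range N, (a n : ℝ) ^ p by
    refine le_trans (le_add_of_nonneg_right ?_) h
    positivity
  induction N with
  | zero => simp
  | succ N ih =>
    rw [Finset.sum_range_succ, Finset.sum_range_succ (fun n => (a n : ℝ) ^ p), mul_add]
    have := hardy_step hp (x := (N : ℝ)⁻¹ * ∑ k ∈ Finset.range N, (a k : ℝ))
      (y := (N + 1 : ℝ)⁻¹ * ∑ k ∈ Finset.range (N + 1), (a k : ℝ)) (a := a N) (n := N)
      (by positivity) (by positivity) (by positivity) (by positivity) (by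
        rw [Finset.sum_range_succ]
        rcases Nat.eq_zero_or_pos N with rfl | hN
        · simp
        · have : (0 : ℝ) < N := by exact_mod_cast hN
          field_simp)
    push_cast
    linarith

/-- Hardy's inequality for sequences in `[0, ∞]`. -/
theorem hardy_tsum {p : ℝ} (hp : 1 < p) (a : ℕ → ℝ≥0∞) :
    ∑' n : ℕ, (((n + 1 : ℕ) : ℝ≥0∞)⁻¹ * ∑ k ∈ Finset.range (n + 1), a k) ^ p ≤
      ENNReal.ofReal ((p / (p - 1)) ^ p) * ∑' n, a n ^ p := by
  have hp0 : 0 < p - 1 := by linarith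
  by_cases ha : ∀ n, a n ≠ ⊤
  · lift a to ℕ → ℝ≥0 using ha
    refine ENNReal.tsum_le_of_sum_range_le fun N => ?_
    have h := ENNReal.ofReal_le_ofReal (hardy_finset hp a N)
    rw [ENNReal.ofReal_mul (by positivity), ENNReal.ofReal_sum_of_nonneg (by intros; positivity),
      ENNReal.ofReal_sum_of_nonneg (by intros; positivity)] at h
    refine le_trans (le_of_eq ?_) (h.trans ?_)
    · refine Finset.sum_congr rfl fun n _ => ?_
      rw [← ENNReal.ofReal_rpow_of_nonneg (by positivity) (by linarith),
        ENNReal.ofReal_mul (by positivity), ENNReal.ofReal_inv_of_pos (by positivity),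
        ENNReal.ofReal_sum_of_nonneg (by intros; positivity)]
      congr 3
      · rw [← Nat.cast_add_one, ENNReal.ofReal_natCast]
      · simp
    · gcongr
      refine le_trans (le_of_eq ?_) (ENNReal.sum_le_tsum (Finset.range N))
      refine Finset.sum_congr rfl fun n _ => ?_
      rw [← ENNReal.ofReal_rpow_of_nonneg (by positivity) (by linarith), ENNReal.ofReal_coe_nnreal]
  · push Not at ha
    obtain ⟨n, hn⟩ := ha
    have : ∑' n, a n ^ p = ⊤ := by
      refine ENNReal.tsum_eq_top_of_eq_top ⟨n, ?_⟩
      rw [hn, ENNReal.top_rpow_of_pos (by linarith)]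
    rw [this, ENNReal.mul_top]
    · exact le_top
    · have : 0 < (p / (p - 1)) ^ p := by positivity
      simpa using this

/-! ### From series to integrals over unit intervals -/

theorem iUnion_Ioc_nat_add_one : ⋃ n : ℕ, Ioc ((n + 1 : ℕ) : ℝ) ((n + 2 : ℕ) : ℝ) = Ioi 1 := by
  ext x
  simp only [mem_iUnion, mem_Ioc, mem_Ioi]
  constructor
  · rintro ⟨n, h, -⟩
    push_cast at h
    have : (0 : ℝ) ≤ n := by positivity
    linarith
  · intro hx
    have h1 : 1 < ⌈x⌉₊ := Nat.lt_ceil.2 (by simpa using hx)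
    refine ⟨⌈x⌉₊ - 2, ?_, ?_⟩
    · exact Nat.lt_ceil.1 (by omega)
    · refine (Nat.le_ceil x).trans ?_
      exact_mod_cast (by omega)

theorem pairwise_disjoint_Ioc_nat_add_one :
    Pairwise (Function.onFun Disjoint fun n : ℕ => Ioc ((n + 1 : ℕ) : ℝ) ((n + 2 : ℕ) : ℝ)) := by
  have h : Monotone fun n : ℕ => ((n + 1 : ℕ) : ℝ) := fun a b hab => by
    dsimp; exact_mod_cast (by omega)
  exact h.pairwise_disjoint_on_Ioc_succ

/-- An integral over `(1, ∞)` is the sum of the integrals over the unit intervals. -/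
theorem lintegral_Ioi_one_eq_tsum (g : ℝ → ℝ≥0∞) :
    ∫⁻ x in Ioi (1 : ℝ), g x =
      ∑' n : ℕ, ∫⁻ x in Ioc ((n + 1 : ℕ) : ℝ) ((n + 2 : ℕ) : ℝ), g x := by
  rw [← iUnion_Ioc_nat_add_one, lintegral_iUnion (fun _ => measurableSet_Ioc)
    pairwise_disjoint_Ioc_nat_add_one]

theorem lintegral_Ioc_one_nat_eq_sum (g : ℝ → ℝ≥0∞) (N : ℕ) :
    ∫⁻ x in Ioc (1 : ℝ) ((N + 1 : ℕ) : ℝ), g x =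
      ∑ n ∈ Finset.range N, ∫⁻ x in Ioc ((n + 1 : ℕ) : ℝ) ((n + 2 : ℕ) : ℝ), g x := by
  induction N with
  | zero => simp
  | succ N ih =>
    rw [Finset.sum_range_succ, ← ih, ← lintegral_union measurableSet_Ioc, Ioc_union_Ioc_eq_Ioc]
    · exact_mod_cast (by omega)
    · exact_mod_cast (by omega)
    · exact Ioc_disjoint_Ioc_of_le le_rfl

theorem lintegral_rpow_le_of_measure_eq_one {α : Type*} [MeasurableSpace α] {μ : Measure α}
    (hμ : μ univ = 1) {p : ℝ} (hp : 1 < p) {g : α → ℝ≥0∞} (hg : AEMeasurable g μ) :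
    (∫⁻ x, g x ∂μ) ^ p ≤ ∫⁻ x, g x ^ p ∂μ := by
  have h := ENNReal.lintegral_mul_le_Lp_mul_Lq μ (Real.HolderConjugate.conjExponent hp) hg
    (aemeasurable_const (b := (1 : ℝ≥0∞)))
  simp only [Pi.mul_apply, mul_one, ENNReal.one_rpow, lintegral_one, hμ] at h
  have := ENNReal.rpow_le_rpow h (show 0 ≤ p by linarith)
  rwa [← ENNReal.rpow_mul, one_div_mul_cancel (by linarith), ENNReal.rpow_one] at this

theorem hardy_sum_integral {p : ℝ} (hp : 1 < p) {f : ℝ → ℝ≥0∞}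
    (hf : AEMeasurable f (volume.restrict (Ioi (1 : ℝ)))) :
    ∑' n : ℕ, (((n + 1 : ℕ) : ℝ≥0∞)⁻¹ * ∫⁻ t in Ioc (1 : ℝ) ((n + 1 : ℕ) : ℝ), f t) ^ p
      ≤ ENNReal.ofReal ((p / (p - 1)) ^ p) * ∫⁻ x in Ioi (1 : ℝ), f x ^ p := by
  set a : ℕ → ℝ≥0∞ := fun n => ∫⁻ x in Ioc ((n + 1 : ℕ) : ℝ) ((n + 2 : ℕ) : ℝ), f x
  calc _ ≤ ∑' n : ℕ, (((n + 1 : ℕ) : ℝ≥0∞)⁻¹ * ∑ k ∈ Finset.range (n + 1), a k) ^ p := by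
        -- The integral up to `n + 1` covers only `n` unit intervals; one more block is added to
        -- match the divisor `n + 1`.
        refine ENNReal.tsum_le_tsum fun n => ENNReal.rpow_le_rpow ?_ (by linarith)
        rw [lintegral_Ioc_one_nat_eq_sum]
        gcongr
        simp
    _ ≤ _ := hardy_tsum hp a
    _ ≤ _ := by
        gcongr
        rw [lintegral_Ioi_one_eq_tsum]
        refine ENNReal.tsum_le_tsum fun n => ?_
        refine lintegral_rpow_le_of_measure_eq_one ?_ hp ?_
        · simp; norm_num
        · refine hf.mono_measure (Measure.restrict_mono ?_ le_rfl)
          rw [← iUnion_Ioc_nat_add_one]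
          exact subset_iUnion (fun n : ℕ => Ioc ((n + 1 : ℕ) : ℝ) ((n + 2 : ℕ) : ℝ)) n

/-! ### Primitives of the Bliss extremal and the beta function -/

/-- The primitive of `(1 + t ^ r) ^ (-q / r)`. -/
noncomputable def blissJ (q r y : ℝ) : ℝ := ∫ t in (0 : ℝ)..y, (1 + |t| ^ r) ^ (-(q / r))

/-- The primitive of `t ^ r (1 + t ^ r) ^ (-q / r)`, the mass distribution of an extremal of
Bliss's inequality. -/
noncomputable def blissH (q r y : ℝ) : ℝ := ∫ t in (0 : ℝ)..y, |t| ^ r * (1 + |t| ^ r) ^ (-(q / r))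

section
variable {q r : ℝ}

theorem one_add_abs_rpow_pos (r t : ℝ) : 0 < 1 + |t| ^ r := by positivity

theorem continuous_one_add_abs_rpow (hr : 0 < r) (s : ℝ) :
    Continuous fun t : ℝ => (1 + |t| ^ r) ^ s :=
  (continuous_const.add (continuous_abs.rpow_const fun _ => Or.inr hr.le)).rpow_const
    fun t => Or.inl (one_add_abs_rpow_pos r t).ne'

theorem continuous_blissH_integrand (hr : 0 < r) (s : ℝ) :
    Continuous fun t : ℝ => |t| ^ r * (1 + |t| ^ r) ^ s :=
  (continuous_abs.rpow_const fun _ => Or.inr hr.le).mul (continuous_one_add_abs_rpow hr s)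

theorem hasDerivAt_blissJ (hr : 0 < r) (q y : ℝ) :
    HasDerivAt (blissJ q r) ((1 + |y| ^ r) ^ (-(q / r))) y :=
  (continuous_one_add_abs_rpow hr _).integral_hasStrictDerivAt 0 y |>.hasDerivAt

theorem hasDerivAt_blissH (hr : 0 < r) (q y : ℝ) :
    HasDerivAt (blissH q r) (|y| ^ r * (1 + |y| ^ r) ^ (-(q / r))) y :=
  (continuous_blissH_integrand hr _).integral_hasStrictDerivAt 0 y |>.hasDerivAt

theorem continuous_blissJ (hr : 0 < r) (q : ℝ) : Continuous (blissJ q r) :=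
  continuous_iff_continuousAt.2 fun y => (hasDerivAt_blissJ hr q y).continuousAt

theorem continuous_blissH (hr : 0 < r) (q : ℝ) : Continuous (blissH q r) :=
  continuous_iff_continuousAt.2 fun y => (hasDerivAt_blissH hr q y).continuousAt

@[simp] theorem blissJ_zero (q r : ℝ) : blissJ q r 0 = 0 := by simp [blissJ]

@[simp] theorem blissH_zero (q r : ℝ) : blissH q r 0 = 0 := by simp [blissH]

theorem strictMono_blissH (hr : 0 < r) (q : ℝ) : StrictMono (blissH q r) := by
  intro x y hxy
  have hc := continuous_blissH_integrand hr (-(q / r))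
  rw [← sub_pos, blissH, blissH, intervalIntegral.integral_interval_sub_left
    (hc.intervalIntegrable _ _) (hc.intervalIntegrable _ _)]
  refine intervalIntegral.integral_pos hxy hc.continuousOn (fun t _ => by positivity) ?_
  rcases eq_or_ne x 0 with rfl | hx
  · exact ⟨y, right_mem_Icc.2 hxy.le, by have : 0 < |y| := abs_pos.2 hxy.ne'; positivity⟩
  · exact ⟨x, left_mem_Icc.2 hxy.le, by have : 0 < |x| := abs_pos.2 hx; positivity⟩

theorem blissJ_pos (hr : 0 < r) (q : ℝ) {y : ℝ} (hy : 0 < y) : 0 < blissJ q r y := by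
  have hc := continuous_one_add_abs_rpow hr (-(q / r))
  exact intervalIntegral.integral_pos hy hc.continuousOn (fun t _ => by positivity)
    ⟨0, left_mem_Icc.2 hy.le, by positivity⟩

theorem blissH_pos (hr : 0 < r) (q : ℝ) {y : ℝ} (hy : 0 < y) : 0 < blissH q r y := by
  simpa using strictMono_blissH hr q hy

/-- Used to bound the transport map from below near 0, where a negative power of it must be
controlled. -/
theorem blissH_le (hr : 0 < r) (hq : 0 < q) {y : ℝ} (hy : 0 ≤ y) :
    blissH q r y ≤ y ^ (r + 1) := by
  have h := intervalIntegral.norm_integral_le_of_norm_le_const (a := 0) (b := y) (C := y ^ r)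
    (f := fun t : ℝ => |t| ^ r * (1 + |t| ^ r) ^ (-(q / r))) (by
      intro t ht
      rw [uIoc_of_le hy] at ht
      rw [Real.norm_of_nonneg (by positivity), abs_of_pos ht.1]
      have h1 : t ^ r ≤ y ^ r := Real.rpow_le_rpow ht.1.le ht.2 hr.le
      have h2 : (1 + t ^ r) ^ (-(q / r)) ≤ 1 :=
        Real.rpow_le_one_of_one_le_of_nonpos
          (le_add_of_nonneg_right (Real.rpow_nonneg ht.1.le r)) (by simp; positivity)
      calc _ ≤ t ^ r * 1 := by
            have := ht.1.le
            gcongr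
        _ ≤ _ := by simpa using h1)
  rw [sub_zero, abs_of_nonneg hy] at h
  rw [Real.rpow_add_one' hy (by linarith)]
  exact (le_abs_self _).trans h

/-- Integration by parts relates the two primitives. -/
theorem blissJ_sub_blissH (hr : 0 < r) (q : ℝ) {y : ℝ} (hy : 0 ≤ y) :
    blissJ q r y - (q - r - 1) * blissH q r y = y * (1 + y ^ r) ^ (1 - q / r) := by
  have hJ := continuous_one_add_abs_rpow hr (-(q / r))
  have hH := continuous_blissH_integrand hr (-(q / r))
  have h := intervalIntegral.integral_eq_sub_of_hasDerivAt_of_le (a := 0) (b := y)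
    (f := fun t : ℝ => t * (1 + |t| ^ r) ^ (1 - q / r))
    (f' := fun t => (1 + |t| ^ r) ^ (-(q / r)) -
      (q - r - 1) * (|t| ^ r * (1 + |t| ^ r) ^ (-(q / r)))) hy
    (continuous_id.mul (continuous_one_add_abs_rpow hr _)).continuousOn ?_
    ((hJ.sub (continuous_const.mul hH)).intervalIntegrable _ _)
  · rw [intervalIntegral.integral_sub (hJ.intervalIntegrable _ _)
      ((hH.intervalIntegrable _ _).const_mul _),
      intervalIntegral.integral_const_mul] at h
    rw [blissJ, blissH, h]
    simp [abs_of_nonneg hy]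
  · intro t ht
    have ht0 : 0 < t := ht.1
    have hpos : 0 < 1 + t ^ r := by positivity
    have h1 : HasDerivAt (fun t : ℝ => t * (1 + t ^ r) ^ (1 - q / r))
        (1 * (1 + t ^ r) ^ (1 - q / r) +
          t * (r * t ^ (r - 1) * (1 - q / r) * (1 + t ^ r) ^ (1 - q / r - 1))) t :=
      (hasDerivAt_id t).mul
        (((Real.hasDerivAt_rpow_const (Or.inl ht0.ne')).const_add 1).rpow_const (Or.inl hpos.ne'))
    have h2 : (fun t : ℝ => t * (1 + |t| ^ r) ^ (1 - q / r)) =ᶠ[nhds t]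
        fun t : ℝ => t * (1 + t ^ r) ^ (1 - q / r) := by
      filter_upwards [lt_mem_nhds ht0] with s hs
      rw [abs_of_pos hs]
    convert! h1.congr_of_eventuallyEq h2 using 1
    rw [abs_of_pos ht0, show 1 - q / r - 1 = -(q / r) by ring,
      show 1 - q / r = -(q / r) + 1 by ring, Real.rpow_add_one hpos.ne',
      Real.rpow_sub_one ht0.ne']
    field_simp
    ring

theorem intervalIntegrable_eulerBeta {a b : ℝ} (ha : 0 < a) (hb : 0 < b) :
    IntervalIntegrable (fun x : ℝ => x ^ (a - 1) * (1 - x) ^ (b - 1)) volume 0 1 := by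
  have h := (Complex.betaIntegral_convergent (u := a) (v := b) (by simpa) (by simpa)).norm
  rw [intervalIntegrable_iff_integrableOn_Ioo_of_le zero_le_one] at h ⊢
  refine h.congr_fun (fun x hx => ?_) measurableSet_Ioo
  have h1 : 0 < 1 - x := sub_pos.2 hx.2
  dsimp only
  rw [norm_mul, Complex.norm_cpow_eq_rpow_re_of_pos hx.1,
    show (1 - (x : ℂ)) = ((1 - x : ℝ) : ℂ) by push_cast; rfl,
    Complex.norm_cpow_eq_rpow_re_of_pos h1]
  simp

theorem eulerBeta_pos {a b : ℝ} (ha : 0 < a) (hb : 0 < b) : 0 < eulerBeta a b := by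
  refine intervalIntegral.intervalIntegral_pos_of_pos_on (intervalIntegrable_eulerBeta ha hb)
    (fun x hx => ?_) zero_lt_one
  have h1 : 0 < 1 - x := sub_pos.2 hx.2
  have := hx.1
  positivity

/-- Substitution `x = t ^ r / (1 + t ^ r)`. The beta integrand may be singular at the endpoints, so
derivatives are compared only in the open interval and continuity is used at its ends. -/
theorem blissJ_eq_incomplete_beta (hr : 0 < r) (hq : 1 < q) {y : ℝ} (hy : 0 ≤ y) :
    r * blissJ q r y = ∫ x in (0 : ℝ)..(y ^ r / (1 + y ^ r)),
      x ^ (1 / r - 1) * (1 - x) ^ ((q - 1) / r - 1) := by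
  set g : ℝ → ℝ := fun x => x ^ (1 / r - 1) * (1 - x) ^ ((q - 1) / r - 1)
  have hg : IntervalIntegrable g volume 0 1 :=
    intervalIntegrable_eulerBeta (by positivity) (div_pos (by linarith) hr)
  have hJ := continuous_one_add_abs_rpow hr (-(q / r))
  have hu : ContinuousOn (fun t : ℝ => t ^ r / (1 + t ^ r)) (Icc 0 y) := by
    have : ContinuousOn (fun t : ℝ => t ^ r) (Icc 0 y) :=
      continuousOn_id.rpow_const fun _ _ => Or.inr hr.le
    refine this.div (continuousOn_const.add this) fun t ht => ?_
    have : 0 ≤ t ^ r := Real.rpow_nonneg ht.1 r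
    positivity
  have hmaps : MapsTo (fun t : ℝ => t ^ r / (1 + t ^ r)) (Icc 0 y) (uIcc 0 1) := by
    intro t ht
    have : 0 ≤ t ^ r := Real.rpow_nonneg ht.1 r
    rw [uIcc_of_le zero_le_one]
    refine ⟨by dsimp; positivity, ?_⟩
    rw [div_le_one (by positivity)]
    linarith
  have h := intervalIntegral.integral_eq_sub_of_hasDerivAt_of_le (a := 0) (b := y)
    (f := fun t : ℝ => ∫ x in (0 : ℝ)..(t ^ r / (1 + t ^ r)), g x)
    (f' := fun t => r * (1 + |t| ^ r) ^ (-(q / r))) hy ?_ ?_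
    ((continuous_const.mul hJ).intervalIntegrable _ _)
  · rw [intervalIntegral.integral_const_mul] at h
    rw [blissJ, h]
    simp [Real.zero_rpow hr.ne']
  · have hprim := intervalIntegral.continuousOn_primitive_interval' hg
      (left_mem_uIcc)
    exact hprim.comp hu hmaps
  · intro t ht
    have ht0 : 0 < t := ht.1
    have htr : 0 < t ^ r := by positivity
    have hpos : 0 < 1 + t ^ r := by positivity
    set u := t ^ r / (1 + t ^ r) with hu_def
    have hu0 : 0 < u := by positivity
    have h1u : 1 - u = (1 + t ^ r)⁻¹ := by rw [hu_def]; field_simp; ring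
    have h1u0 : 0 < 1 - u := by rw [h1u]; positivity
    have hgc : ∀ x ∈ Ioo (0 : ℝ) 1, ContinuousAt g x := fun x hx =>
      (continuousAt_id.rpow_const (Or.inl hx.1.ne')).mul
        ((continuousAt_const.sub continuousAt_id).rpow_const
          (Or.inl (sub_pos.2 hx.2).ne'))
    have hug : u ∈ Ioo (0 : ℝ) 1 := ⟨hu0, by linarith⟩
    have hprim : HasDerivAt (fun z => ∫ x in (0 : ℝ)..z, g x) (g u) u := by
      refine intervalIntegral.integral_hasDerivAt_right
        (hg.mono_set (uIcc_subset_uIcc left_mem_uIcc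
          (by rw [uIcc_of_le zero_le_one]; exact ⟨hu0.le, hug.2.le⟩))) ?_ (hgc u hug)
      refine ContinuousOn.stronglyMeasurableAtFilter isOpen_Ioo
        (fun x hx => (hgc x hx).continuousWithinAt) u hug
    have hd := Real.hasDerivAt_rpow_const (x := t) (p := r) (Or.inl ht0.ne')
    have hud := hd.div (hd.const_add 1) hpos.ne'
    convert! hprim.comp t hud using 1
    simp only [g]
    rw [h1u, hu_def, abs_of_pos ht0]
    -- Writing the positive quantities as exponentials reduces an identity between real powers to a
    -- linear one between exponents; the same device recurs below.
    obtain ⟨s, hs⟩ : ∃ s, Real.exp s = 1 + t ^ r := ⟨_, Real.exp_log hpos⟩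
    obtain ⟨τ, rfl⟩ : ∃ τ, Real.exp τ = t := ⟨_, Real.exp_log ht0⟩
    have e1 : (r * Real.exp τ ^ (r - 1) * (1 + Real.exp τ ^ r) -
        Real.exp τ ^ r * (r * Real.exp τ ^ (r - 1))) = r * Real.exp τ ^ (r - 1) := by ring
    rw [e1, ← hs]
    simp only [← Real.exp_mul, ← Real.exp_neg, ← Real.exp_sub, ← Real.exp_nat_mul]
    rw [mul_div_assoc, ← Real.exp_sub, ← Real.exp_add, mul_left_comm, ← Real.exp_add]
    congr 2
    push_cast
    field_simp
    ring

theorem tendsto_rpow_div_one_add_rpow (hr : 0 < r) :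
    Filter.Tendsto (fun y : ℝ => y ^ r / (1 + y ^ r)) Filter.atTop (nhds 1) := by
  have h : Filter.Tendsto (fun y : ℝ => 1 - (1 + y ^ r)⁻¹) Filter.atTop (nhds (1 - 0)) :=
    tendsto_const_nhds.sub
      (Filter.tendsto_atTop_add_const_left _ 1 (tendsto_rpow_atTop hr)).inv_tendsto_atTop
  rw [sub_zero] at h
  refine h.congr' ?_
  filter_upwards [Filter.eventually_ge_atTop 0] with y hy
  have : 0 ≤ y ^ r := Real.rpow_nonneg hy r
  field_simp
  ring

theorem tendsto_blissJ (hr : 0 < r) (hq : 1 < q) :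
    Filter.Tendsto (blissJ q r) Filter.atTop (nhds (eulerBeta (1 / r) ((q - 1) / r) / r)) := by
  have hg := intervalIntegrable_eulerBeta (a := 1 / r) (b := (q - 1) / r) (by positivity)
    (div_pos (by linarith) hr)
  have hprim := (intervalIntegral.continuousOn_primitive_interval' hg left_mem_uIcc) 1 right_mem_uIcc
  have hw : Filter.Tendsto (fun y : ℝ => y ^ r / (1 + y ^ r)) Filter.atTop
      (nhdsWithin 1 (uIcc 0 1)) := by
    refine tendsto_nhdsWithin_iff.2 ⟨tendsto_rpow_div_one_add_rpow hr, ?_⟩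
    filter_upwards [Filter.eventually_ge_atTop 0] with y hy
    have : 0 ≤ y ^ r := Real.rpow_nonneg hy r
    rw [uIcc_of_le zero_le_one]
    refine ⟨by positivity, ?_⟩
    rw [div_le_one (by positivity)]
    linarith
  refine ((hprim.tendsto.comp hw).div_const r).congr' ?_
  filter_upwards [Filter.eventually_ge_atTop 0] with y hy
  rw [Function.comp_apply, ← blissJ_eq_incomplete_beta hr hq hy]
  field_simp

/-- The boundary term in `blissJ_sub_blissH` is at most `y ^ (-(q - r - 1))`, so in the limit the
two primitives differ by the factor `q - r - 1`. -/
theorem tendsto_blissH (hr : 0 < r) (hq : r + 1 < q) :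
    Filter.Tendsto (blissH q r) Filter.atTop
      (nhds (eulerBeta (1 / r) ((q - 1) / r) / r / (q - r - 1))) := by
  have hc : 0 < q - r - 1 := by linarith
  have hE : Filter.Tendsto (fun y : ℝ => y * (1 + y ^ r) ^ (1 - q / r)) Filter.atTop (nhds 0) := by
    refine squeeze_zero' (g := fun y : ℝ => y ^ (-(q - r - 1))) ?_ ?_ (tendsto_rpow_neg_atTop hc)
    · filter_upwards [Filter.eventually_ge_atTop 0] with y hy
      positivity
    · filter_upwards [Filter.eventually_gt_atTop 0] with y hy
      have h1 : (1 + y ^ r) ^ (1 - q / r) ≤ (y ^ r) ^ (1 - q / r) := by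
        refine Real.rpow_le_rpow_of_nonpos (by positivity) (by linarith) ?_
        rw [sub_nonpos, one_le_div hr]
        linarith
      calc _ ≤ y * (y ^ r) ^ (1 - q / r) := by gcongr
        _ = y ^ (1 + r * (1 - q / r)) := by
            rw [Real.rpow_add hy, Real.rpow_one, Real.rpow_mul hy.le]
        _ = _ := by congr 1; field_simp; ring
  have := ((tendsto_blissJ hr (by linarith : 1 < q)).sub hE).div_const (q - r - 1)
  rw [sub_zero] at this
  refine this.congr' ?_
  filter_upwards [Filter.eventually_ge_atTop 0] with y hy
  rw [← blissJ_sub_blissH hr q hy]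
  field_simp
  ring

end

/-! ### Bliss's inequality by mass transport -/

/-- The arithmetic-geometric step in the transport proof of Bliss's inequality. -/
theorem bliss_amgm {p q r F T x θ E D : ℝ} (hp : 1 < p) (hr : 0 < r) (hq : q = p * (1 + r))
    (hF : 0 < F) (hT : 0 < T) (hx : 0 < x) (hθ : 0 < θ) (hE : 0 < E)
    (hD : D = θ * (F ^ q * x ^ (r - q)) / (T ^ r * E ^ (-(q / r)))) :
    (q - r - 1) * θ ^ (-(1 - r / q)) * (E ^ (1 - q / r) * D) ≤
      r * (p - 1) / p * (F ^ (q - r) * T ^ (-(r * (p - 1) / p) - 1) * D *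
        x ^ (r * (p - 1) / p - (q - r - 1))) +
      (q - r - 1 - r * (p - 1) / p) * (F ^ (q - r) * T ^ (-(r * (p - 1) / p)) *
        x ^ (r * (p - 1) / p - (q - r - 1) - 1)) := by
  have hq0 : 0 < q := by rw [hq]; positivity
  have hp1 : 0 < p - 1 := by linarith
  have hc : 0 < q - r - 1 := by rw [hq]; nlinarith [mul_pos hp1 hr]
  have hrq : r < q := by linarith
  have hac : r * (p - 1) / p = (q - r - 1) * (r / q) := by rw [hq]; field_simp; ring
  have hD0 : 0 < D := by rw [hD]; positivity
  set a := r * (p - 1) / p with ha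
  set u := F ^ (q - r) * T ^ (-a - 1) * D * x ^ (a - (q - r - 1)) with hu
  set v := F ^ (q - r) * T ^ (-a) * x ^ (a - (q - r - 1) - 1) with hv
  -- The terms `u` and `v` come from differentiating the powers of `T` and `x` in `F ^ (q - r) * T ^
  -- (-a) * x ^ (a - c)`, where `c = q - r - 1`. Since `a = c * (r / q)`, their coefficients `a` and
  -- `c - a` are `c` times the weights. The mass balance `hD` then removes `F` and `x` from the
  -- geometric mean.
  have h := Real.geom_mean_le_arith_mean2_weighted (w₁ := r / q) (w₂ := 1 - r / q) (p₁ := u)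
    (p₂ := v) (by positivity) (by rw [sub_nonneg, div_le_one hq0]; exact hrq.le)
    (by positivity) (by positivity) (by ring)
  have hgm : u ^ (r / q) * v ^ (1 - r / q) = θ ^ (-(1 - r / q)) * (E ^ (1 - q / r) * D) := by
    rw [hu, hv, hD]
    obtain ⟨F, rfl⟩ : ∃ s, Real.exp s = F := ⟨_, Real.exp_log hF⟩
    obtain ⟨T, rfl⟩ : ∃ s, Real.exp s = T := ⟨_, Real.exp_log hT⟩
    obtain ⟨x, rfl⟩ : ∃ s, Real.exp s = x := ⟨_, Real.exp_log hx⟩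
    obtain ⟨θ, rfl⟩ : ∃ s, Real.exp s = θ := ⟨_, Real.exp_log hθ⟩
    obtain ⟨E, rfl⟩ : ∃ s, Real.exp s = E := ⟨_, Real.exp_log hE⟩
    simp only [← Real.exp_mul, ← Real.exp_sub, ← Real.exp_add]
    congr 1
    rw [ha, hq]
    field_simp
    ring
  calc _ = (q - r - 1) * (u ^ (r / q) * v ^ (1 - r / q)) := by rw [hgm]; ring
    _ ≤ (q - r - 1) * (r / q * u + (1 - r / q) * v) := by gcongr
    _ = _ := by rw [hac]; ring

/-- The step using Young's inequality in the transport proof of Bliss's inequality. -/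
theorem bliss_young {p q r F T x θ E D f μ : ℝ} (hp : 1 < p) (hr : 0 < r) (hq : q = p * (1 + r))
    (hF : 0 < F) (hT : 0 < T) (hx : 0 < x) (hθ : 0 < θ) (hE : 0 < E) (hμ : 0 < μ) (hf : 0 ≤ f)
    (hD : D = θ * (F ^ q * x ^ (r - q)) / (T ^ r * E ^ (-(q / r)))) :
    f * F ^ (q - r - 1) * T ^ (-(r * (p - 1) / p)) * x ^ (r * (p - 1) / p - (q - r - 1)) ≤
      μ * f ^ p / p + μ ^ (-(1 / (p - 1))) * θ⁻¹ * (E ^ (-(q / r)) * D) * (1 - 1 / p) := by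
  have hp1 : 0 < p - 1 := by linarith
  -- The parameter `μ` is kept free, to be optimised after integration. By `hD`, the conjugate power
  -- of the second factor is a multiple of the derivative of `blissJ` along `T`.
  have h := Real.young_inequality_of_nonneg (a := μ ^ (1 / p) * f)
    (b := μ ^ (-(1 / p)) * (F ^ (q - r - 1) * T ^ (-(r * (p - 1) / p)) *
      x ^ (r * (p - 1) / p - (q - r - 1)))) (by positivity) (by positivity)
    (Real.HolderConjugate.conjExponent hp)
  rw [Real.mul_rpow (by positivity) hf, ← Real.rpow_mul hμ.le, one_div_mul_cancel (by linarith),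
    Real.rpow_one] at h
  calc _ = μ ^ (1 / p) * f * (μ ^ (-(1 / p)) * (F ^ (q - r - 1) * T ^ (-(r * (p - 1) / p)) *
      x ^ (r * (p - 1) / p - (q - r - 1)))) := by
        have : μ ^ (1 / p) * μ ^ (-(1 / p)) = 1 := by
          rw [← Real.rpow_add hμ]; simp
        linear_combination -(f * F ^ (q - r - 1) * T ^ (-(r * (p - 1) / p)) *
          x ^ (r * (p - 1) / p - (q - r - 1))) * this
    _ ≤ _ := h
    _ = _ := by
        rw [show p.conjExponent = p / (p - 1) from rfl, div_eq_mul_inv _ (p / (p - 1))]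
        congr 1
        rw [show (p / (p - 1))⁻¹ = 1 - 1 / p by field_simp]
        congr 1
        rw [hD]
        obtain ⟨F, rfl⟩ : ∃ s, Real.exp s = F := ⟨_, Real.exp_log hF⟩
        obtain ⟨T, rfl⟩ : ∃ s, Real.exp s = T := ⟨_, Real.exp_log hT⟩
        obtain ⟨x, rfl⟩ : ∃ s, Real.exp s = x := ⟨_, Real.exp_log hx⟩
        obtain ⟨θ, rfl⟩ : ∃ s, Real.exp s = θ := ⟨_, Real.exp_log hθ⟩
        obtain ⟨E, rfl⟩ : ∃ s, Real.exp s = E := ⟨_, Real.exp_log hE⟩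
        obtain ⟨μ, rfl⟩ : ∃ s, Real.exp s = μ := ⟨_, Real.exp_log hμ⟩
        simp only [← Real.exp_mul, ← Real.exp_sub, ← Real.exp_add, ← Real.exp_neg]
        congr 1
        rw [hq]
        field_simp
        ring

/-- The transport map: a local inverse of `blissH`. -/
theorem exists_blissH_inverse {r : ℝ} (hr : 0 < r) (q : ℝ) {Y : ℝ} (hY : 0 < Y) :
    ∃ g : ℝ → ℝ, ContinuousOn g (Icc 0 (blissH q r Y)) ∧
      (∀ z ∈ Icc 0 (blissH q r Y), blissH q r (g z) = z) ∧
      ∀ z ∈ Ioo 0 (blissH q r Y),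
        HasDerivAt g (g z ^ r * (1 + g z ^ r) ^ (-(q / r)))⁻¹ z := by
  have hc := continuous_blissH hr q
  have hm := strictMono_blissH hr q
  have hsurj : ∀ z ∈ Icc 0 (blissH q r Y), ∃ y, blissH q r y = z := by
    intro z hz
    obtain ⟨y, -, hy⟩ := intermediate_value_Icc hY.le hc.continuousOn (by simpa using hz)
    exact ⟨y, hy⟩
  choose! g hg using hsurj
  -- A strictly increasing map with order-connected range is an embedding, so `g` is continuous
  -- because `blissH q r ∘ g` is the identity on the interval.
  have hemb : Topology.IsEmbedding (blissH q r) :=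
    hm.isEmbedding_of_ordConnected (isPreconnected_range hc).ordConnected
  have hgc : ContinuousOn g (Icc 0 (blissH q r Y)) := by
    rw [hemb.continuousOn_iff]
    exact continuousOn_id.congr fun z hz => hg z hz
  refine ⟨g, hgc, hg, fun z hz => ?_⟩
  have hgz : 0 < g z := by
    rw [← hm.lt_iff_lt, hg z (Ioo_subset_Icc_self hz), blissH_zero]
    exact hz.1
  refine HasDerivAt.of_local_left_inverse (hgc.continuousAt (Icc_mem_nhds hz.1 hz.2))
    (by simpa only [abs_of_pos hgz] using hasDerivAt_blissH hr q (g z)) (by positivity) ?_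
  filter_upwards [Icc_mem_nhds hz.1 hz.2] with w hw using hg w hw

/-- The transport inequality behind Bliss's inequality, with free parameters `μ` and `Y`. Here `F`
is a primitive of `f`, `P` one of `f ^ p` and `G` one of `F ^ q x ^ (r - q)`. -/
theorem bliss_transport {p q r : ℝ} (hp : 1 < p) (hr : 0 < r) (hq : q = p * (1 + r))
    {F f P G : ℝ → ℝ} {X Y α β θ μ : ℝ} (hX : 0 < X) (hY : 0 < Y) (hβ : 0 < β) (hμ : 0 < μ)
    (hf : ∀ x, 0 ≤ f x) (hFc : Continuous F) (hFpos : ∀ x, 0 < x → 0 < F x)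
    (hF' : ∀ x, 0 < x → HasDerivWithinAt F (f x) (Ici x) x)
    (hPc : Continuous P) (hP0 : ∀ x, 0 ≤ x → 0 ≤ P x)
    (hP' : ∀ x, 0 < x → HasDerivWithinAt P (f x ^ p) (Ici x) x)
    (hGc : Continuous G) (hG0 : G 0 = 0)
    (hG' : ∀ x, 0 < x → HasDerivAt G (F x ^ q * x ^ (r - q)) x)
    (hFα : ∀ x ∈ Ioc (0 : ℝ) 1, F x = α * x) (hGβ : ∀ x ∈ Ioc (0 : ℝ) 1, β * x ^ (r + 1) ≤ G x)
    (hθ : θ * G X = blissH q r Y) :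
    (q - r - 1) * θ ^ (-(1 - r / q)) * (blissJ q r Y + blissH q r Y) ≤
      (q - r) * (μ * P X / p + μ ^ (-(1 / (p - 1))) * θ⁻¹ * blissJ q r Y * (1 - 1 / p)) := by
  have hq0 : 0 < q := by rw [hq]; positivity
  have hp1 : 0 < p - 1 := by linarith
  have hc : 0 < q - r - 1 := by rw [hq]; nlinarith [mul_pos hp1 hr]
  have hH := strictMono_blissH hr q
  have hHY := blissH_pos hr q hY
  have hGm : StrictMonoOn G (Ici 0) := by
    refine strictMonoOn_of_deriv_pos (convex_Ici 0) hGc.continuousOn fun x hx => ?_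
    rw [interior_Ici] at hx
    have hx : 0 < x := hx
    rw [(hG' x hx).deriv]
    have := hFpos x hx
    positivity
  have hGpos : ∀ x, 0 < x → 0 < G x := fun x hx => by
    rw [← hG0]; exact hGm self_mem_Ici hx.le hx
  have hθ0 : 0 < θ := by
    have := hGpos X hX
    by_contra h
    push Not at h
    nlinarith [mul_nonneg_of_nonpos_of_nonpos h (neg_nonpos.2 this.le)]
  obtain ⟨g, hgc, hg, hg'⟩ := exists_blissH_inverse hr q hY
  have hmaps : ∀ x ∈ Icc 0 X, θ * G x ∈ Icc 0 (blissH q r Y) := by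
    intro x hx
    rw [← hθ]
    refine ⟨mul_nonneg hθ0.le ?_, ?_⟩
    · rcases hx.1.eq_or_lt with h | h
      · rw [← h, hG0]
      · exact (hGpos x h).le
    · gcongr
      exact hGm.monotoneOn hx.1 (hX.le : (0 : ℝ) ≤ X) hx.2
  -- `T` carries the mass with primitive `θ * G` to the one with primitive `blissH q r`. The factor
  -- `θ` equalises the total masses on `[0, X]` and `[0, Y]`, whence `T X = Y`.
  set T : ℝ → ℝ := fun x => g (θ * G x) with hTdef
  have hTc : ContinuousOn T (Icc 0 X) :=
    hgc.comp (continuous_const.mul hGc).continuousOn hmaps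
  have hHT : ∀ x ∈ Icc 0 X, blissH q r (T x) = θ * G x := fun x hx => hg _ (hmaps x hx)
  have hT0 : T 0 = 0 := hH.injective (by rw [hHT 0 ⟨le_rfl, hX.le⟩, hG0]; simp)
  have hTX : T X = Y := hH.injective (by rw [hHT X ⟨hX.le, le_rfl⟩, hθ])
  have hTpos : ∀ x ∈ Ioc 0 X, 0 < T x := fun x hx => by
    rw [← hH.lt_iff_lt, hHT x (Ioc_subset_Icc_self hx), blissH_zero]
    exact mul_pos hθ0 (hGpos x hx.1)
  set D : ℝ → ℝ := fun x =>
    θ * (F x ^ q * x ^ (r - q)) / (T x ^ r * (1 + T x ^ r) ^ (-(q / r))) with hD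
  have hT' : ∀ x ∈ Ioo 0 X, HasDerivAt T (D x) x := by
    intro x hx
    have hz : θ * G x ∈ Ioo 0 (blissH q r Y) := by
      refine ⟨mul_pos hθ0 (hGpos x hx.1), ?_⟩
      rw [← hθ]
      exact mul_lt_mul_of_pos_left (hGm hx.1.le (hX.le : (0 : ℝ) ≤ X) hx.2) hθ0
    convert! (hg' _ hz).comp x ((hG' x hx.1).const_mul θ) using 1
    exact div_eq_inv_mul _ _
  set a := r * (p - 1) / p with ha
  have ha0 : 0 < a := by positivity
  set c := q - r - 1 with hcdef
  set k₁ := c * θ ^ (-(1 - r / q)) with hk₁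
  set k₂ := μ ^ (-(1 / (p - 1))) * θ⁻¹ with hk₂
  -- The first summand is the auxiliary product whose derivative links the two pointwise
  -- inequalities. The derivative of `k₁ * (blissJ + blissH)` along `T` is the left side of
  -- `bliss_amgm`, and that of the subtracted bracket is the right side of `bliss_young`. So `Z` is
  -- nonincreasing, and `Z X ≤ 0` gives the claim once the nonnegative product is dropped.
  set Z : ℝ → ℝ := fun x => F x ^ (q - r) * T x ^ (-a) * x ^ (a - c) +
    k₁ * (blissJ q r (T x) + blissH q r (T x)) -
    (q - r) * (μ * P x / p + k₂ * blissJ q r (T x) * (1 - 1 / p)) with hZ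
  have hZle : ∀ ε ∈ Ioc 0 X, Z X ≤ Z ε := by
    intro ε hε
    have hsub : Icc ε X ⊆ Icc 0 X := Icc_subset_Icc_left hε.1.le
    have hTε := hTc.mono hsub
    have hcont : ContinuousOn Z (Icc ε X) := by
      have hJT : ContinuousOn (fun x => blissJ q r (T x)) (Icc ε X) :=
        (continuous_blissJ hr q).comp_continuousOn hTε
      have hHT : ContinuousOn (fun x => blissH q r (T x)) (Icc ε X) :=
        (continuous_blissH hr q).comp_continuousOn hTε
      have h1 : ContinuousOn (fun x => F x ^ (q - r)) (Icc ε X) :=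
        hFc.continuousOn.rpow_const fun x hx => Or.inl (hFpos x (hε.1.trans_le hx.1)).ne'
      have h2 : ContinuousOn (fun x => T x ^ (-a)) (Icc ε X) :=
        hTε.rpow_const fun x hx => Or.inl (hTpos x ⟨hε.1.trans_le hx.1, hx.2⟩).ne'
      have h3 : ContinuousOn (fun x : ℝ => x ^ (a - c)) (Icc ε X) :=
        continuousOn_id.rpow_const fun x hx => Or.inl (hε.1.trans_le hx.1).ne'
      exact (((h1.mul h2).mul h3).add (continuousOn_const.mul (hJT.add hHT))).sub
        (continuousOn_const.mul (((continuousOn_const.mul hPc.continuousOn).div_const _).add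
          ((continuousOn_const.mul hJT).mul continuousOn_const)))
    have hder : ∀ x ∈ Ico ε X, ∃ z, HasDerivWithinAt Z z (Ici x) x ∧ z ≤ 0 := by
      intro x hx
      have hx0 : 0 < x := hε.1.trans_le hx.1
      have hTx : 0 < T x := hTpos x ⟨hx0, hx.2.le⟩
      have hFx := hFpos x hx0
      have hE : 0 < 1 + T x ^ r := by positivity
      have dT := (hT' x ⟨hx0, hx.2⟩).hasDerivWithinAt (s := Ici x)
      have dF := hF' x hx0
      have dW := ((dF.rpow_const (p := q - r) (Or.inl hFx.ne')).mul
        (dT.rpow_const (p := -a) (Or.inl hTx.ne'))).mul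
        (Real.hasDerivAt_rpow_const (x := x) (p := a - c) (Or.inl hx0.ne')).hasDerivWithinAt
      have dJ := (hasDerivAt_blissJ hr q (T x)).comp_hasDerivWithinAt x dT
      have dH := (hasDerivAt_blissH hr q (T x)).comp_hasDerivWithinAt x dT
      have dZ := (dW.add ((dJ.add dH).const_mul k₁)).sub
        (((((hP' x hx0).const_mul μ).div_const p).add
          ((dJ.const_mul k₂).mul_const (1 - 1 / p))).const_mul (q - r))
      refine ⟨_, dZ, ?_⟩
      have h1 := bliss_amgm hp hr hq hFx hTx hx0 hθ0 hE (rfl : D x = D x)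
      have h2 := bliss_young hp hr hq hFx hTx hx0 hθ0 hE hμ (hf x) (rfl : D x = D x)
      have h2' := mul_le_mul_of_nonneg_left h2 (show 0 ≤ q - r by linarith)
      rw [← ha, ← hcdef] at h1 h2'
      rw [← hk₁] at h1
      rw [← hk₂] at h2'
      have hE1 : (1 + T x ^ r) ^ (1 - q / r) =
          (1 + T x ^ r) ^ (-(q / r)) + T x ^ r * (1 + T x ^ r) ^ (-(q / r)) := by
        rw [show 1 - q / r = -(q / r) + 1 by ring, Real.rpow_add_one hE.ne']
        ring
      rw [hE1] at h1
      rw [abs_of_pos hTx, show q - r - 1 = c from rfl]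
      simp only [Pi.mul_apply]
      linear_combination h1 + h2'
    choose! Z' hZ' hZ'0 using hder
    -- Right derivatives suffice, which admits functions `f` with jumps.
    exact image_le_of_deriv_right_le_deriv_boundary hcont hZ' (B := fun _ => Z ε)
      (B' := fun _ => 0) le_rfl continuousOn_const (fun x _ => hasDerivWithinAt_const _ _ _)
      hZ'0 (right_mem_Icc.2 hε.2)
  have hlim : Z X ≤ 0 := by
    -- From `θ * β * ε ^ (r + 1) ≤ θ * G ε = blissH q r (T ε) ≤ T ε ^ (r + 1)` one gets `η * ε ≤ T
    -- ε`. The product in `Z ε` is then at most a constant times `ε`, as its exponents add up to 1.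
    set η := (θ * β) ^ (1 / (r + 1)) with hη
    have hη0 : 0 < η := by positivity
    have hα : 0 < α := by
      have h := hFpos 1 one_pos
      rw [hFα 1 ⟨one_pos, le_rfl⟩] at h
      simpa using h
    have hbound : ∀ ε ∈ Ioc 0 (min X 1), Z X ≤ α ^ (q - r) * η ^ (-a) * ε +
        k₁ * (blissJ q r (T ε) + blissH q r (T ε)) := by
      intro ε hε
      have hεX : ε ∈ Ioc 0 X := ⟨hε.1, hε.2.trans (min_le_left _ _)⟩
      have hε1 : ε ∈ Ioc (0 : ℝ) 1 := ⟨hε.1, hε.2.trans (min_le_right _ _)⟩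
      have hε0 : 0 < ε := hε.1
      have hTε := hTpos ε hεX
      have hle : η * ε ≤ T ε := by
        have h1 : (η * ε) ^ (r + 1) ≤ T ε ^ (r + 1) := by
          rw [Real.mul_rpow hη0.le hε0.le, hη, ← Real.rpow_mul (by positivity),
            one_div_mul_cancel (by positivity), Real.rpow_one]
          calc θ * β * ε ^ (r + 1) = θ * (β * ε ^ (r + 1)) := by ring
            _ ≤ θ * G ε := by gcongr; exact hGβ ε hε1
            _ = blissH q r (T ε) := (hHT ε (Ioc_subset_Icc_self hεX)).symm
            _ ≤ _ := blissH_le hr hq0 hTε.le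
        exact (Real.rpow_le_rpow_iff (by positivity) hTε.le (by positivity)).1 h1
      refine (hZle ε hεX).trans ?_
      have hW : F ε ^ (q - r) * T ε ^ (-a) * ε ^ (a - c) ≤ α ^ (q - r) * η ^ (-a) * ε := by
        calc _ ≤ F ε ^ (q - r) * (η * ε) ^ (-a) * ε ^ (a - c) := by
              have := hFpos ε hε0
              exact mul_le_mul_of_nonneg_right (mul_le_mul_of_nonneg_left
                (Real.rpow_le_rpow_of_nonpos (by positivity) hle (neg_nonpos.2 ha0.le))
                (by positivity)) (by positivity)
          _ = α ^ (q - r) * η ^ (-a) * (ε ^ (q - r) * ε ^ (-a) * ε ^ (a - c)) := by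
              rw [hFα ε hε1, Real.mul_rpow hα.le hε0.le, Real.mul_rpow hη0.le hε0.le]; ring
          _ = _ := by
              rw [← Real.rpow_add hε0, ← Real.rpow_add hε0,
                show q - r + -a + (a - c) = 1 by rw [hcdef]; ring, Real.rpow_one]
      have h3 : 0 ≤ (q - r) * (μ * P ε / p + k₂ * blissJ q r (T ε) * (1 - 1 / p)) := by
        have h4 := hP0 ε hε0.le
        have h5 := blissJ_pos hr q hTε
        have h6 : 0 ≤ 1 - 1 / p := by
          rw [sub_nonneg, div_le_one (by linarith)]; exact hp.le
        have h7 : 0 ≤ q - r := by linarith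
        positivity
      rw [hZ]
      linarith
    have hTt : Filter.Tendsto T (nhdsWithin 0 (Ioc 0 (min X 1))) (nhds 0) := by
      have h := hTc 0 ⟨le_rfl, hX.le⟩
      rw [ContinuousWithinAt, hT0] at h
      refine h.mono_left (nhdsWithin_mono _ fun x hx => ⟨hx.1.le, hx.2.trans (min_le_left _ _)⟩)
    have hJt := ((continuous_blissJ hr q).tendsto 0).comp hTt
    have hHt := ((continuous_blissH hr q).tendsto 0).comp hTt
    have hεt : Filter.Tendsto (fun ε : ℝ => ε) (nhdsWithin 0 (Ioc 0 (min X 1))) (nhds 0) :=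
      Filter.tendsto_id.mono_left nhdsWithin_le_nhds
    have ht := (hεt.const_mul (α ^ (q - r) * η ^ (-a))).add ((hJt.add hHt).const_mul k₁)
    simp only [blissJ_zero, blissH_zero, mul_zero, add_zero] at ht
    have hne : (nhdsWithin (0 : ℝ) (Ioc 0 (min X 1))).NeBot :=
      left_nhdsWithin_Ioc_neBot (lt_min hX one_pos)
    exact ge_of_tendsto ht (Filter.eventually_of_mem self_mem_nhdsWithin hbound)
  have hWX : 0 ≤ F X ^ (q - r) * T X ^ (-a) * X ^ (a - c) := by
    have := hFpos X hX
    have := hTpos X ⟨hX, le_rfl⟩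
    positivity
  simp only [hZ, hTX] at hlim hWX
  linarith

/-- The transport inequality with optimal `μ`. -/
theorem bliss_transport_optimal {p q r : ℝ} (hp : 1 < p) (hr : 0 < r) (hq : q = p * (1 + r))
    {G P J H I : ℝ} (hG : 0 < G) (hP : 0 < P) (hJ : 0 < J) (hH : 0 < H)
    (h : ∀ μ, 0 < μ → (q - r - 1) * (H / G) ^ (-(1 - r / q)) * I ≤
      (q - r) * (μ * P / p + μ ^ (-(1 / (p - 1))) * (H / G)⁻¹ * J * (1 - 1 / p))) :
    (q - r - 1) * I * G ^ (1 / q) ≤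
      (q - r) * P ^ (1 / p) * J ^ (1 - 1 / p) * H ^ (1 / q) := by
  have hq0 : 0 < q := by rw [hq]; positivity
  have hp1 : 0 < p - 1 := by linarith
  -- This `μ` makes the two terms equal before weighting by `1 / p` and `1 - 1 / p`, which is the
  -- minimum over `μ`.
  have h1 := h ((J / (H / G * P)) ^ (1 - 1 / p)) (by positivity)
  have e1 : (J / (H / G * P)) ^ (1 - 1 / p) * P =
      (H / G) ^ (-(1 - 1 / p)) * (P ^ (1 / p) * J ^ (1 - 1 / p)) := by
    obtain ⟨G, rfl⟩ : ∃ s, Real.exp s = G := ⟨_, Real.exp_log hG⟩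
    obtain ⟨P, rfl⟩ : ∃ s, Real.exp s = P := ⟨_, Real.exp_log hP⟩
    obtain ⟨J, rfl⟩ : ∃ s, Real.exp s = J := ⟨_, Real.exp_log hJ⟩
    obtain ⟨H, rfl⟩ : ∃ s, Real.exp s = H := ⟨_, Real.exp_log hH⟩
    simp only [← Real.exp_mul, ← Real.exp_sub, ← Real.exp_add]
    congr 1
    ring
  have e2 : ((J / (H / G * P)) ^ (1 - 1 / p)) ^ (-(1 / (p - 1))) * (H / G)⁻¹ * J =
      (H / G) ^ (-(1 - 1 / p)) * (P ^ (1 / p) * J ^ (1 - 1 / p)) := by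
    obtain ⟨G, rfl⟩ : ∃ s, Real.exp s = G := ⟨_, Real.exp_log hG⟩
    obtain ⟨P, rfl⟩ : ∃ s, Real.exp s = P := ⟨_, Real.exp_log hP⟩
    obtain ⟨J, rfl⟩ : ∃ s, Real.exp s = J := ⟨_, Real.exp_log hJ⟩
    obtain ⟨H, rfl⟩ : ∃ s, Real.exp s = H := ⟨_, Real.exp_log hH⟩
    simp only [← Real.exp_mul, ← Real.exp_sub, ← Real.exp_add, ← Real.exp_neg]
    congr 1
    field_simp
    ring
  rw [e1, e2] at h1
  -- The power of `H` cancels because `(1 + r) / q = 1 / p`.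
  have e3 : (H / G) ^ (1 - 1 / p) * (H / G) ^ (-(1 - r / q)) * H ^ (1 / q) = G ^ (1 / q) := by
    obtain ⟨G, rfl⟩ : ∃ s, Real.exp s = G := ⟨_, Real.exp_log hG⟩
    obtain ⟨H, rfl⟩ : ∃ s, Real.exp s = H := ⟨_, Real.exp_log hH⟩
    simp only [← Real.exp_mul, ← Real.exp_sub, ← Real.exp_add]
    congr 1
    rw [hq]
    field_simp
    ring
  have e4 : (H / G) ^ (1 - 1 / p) * (H / G) ^ (-(1 - 1 / p)) = 1 := by
    rw [← Real.rpow_add (by positivity)]; simp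
  have h2 := mul_le_mul_of_nonneg_left h1
    (show 0 ≤ (H / G) ^ (1 - 1 / p) * H ^ (1 / q) by positivity)
  calc _ = (H / G) ^ (1 - 1 / p) * H ^ (1 / q) *
        ((q - r - 1) * (H / G) ^ (-(1 - r / q)) * I) := by rw [← e3]; ring
    _ ≤ _ := h2
    _ = ((H / G) ^ (1 - 1 / p) * (H / G) ^ (-(1 - 1 / p))) *
        ((q - r) * P ^ (1 / p) * J ^ (1 - 1 / p) * H ^ (1 / q)) := by field_simp; ring
    _ = _ := by rw [e4, one_mul]

/-- Bliss's inequality with the sharp constant, for `F` a primitive of `f`, `P` one of `f ^ p` and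
`G` one of `F ^ q x ^ (r - q)`. -/
theorem bliss_inequality {p q r : ℝ} (hp : 1 < p) (hr : 0 < r) (hq : q = p * (1 + r))
    {F f P G : ℝ → ℝ} {X α β : ℝ} (hX : 0 < X) (hβ : 0 < β)
    (hf : ∀ x, 0 ≤ f x) (hFc : Continuous F) (hFpos : ∀ x, 0 < x → 0 < F x)
    (hF' : ∀ x, 0 < x → HasDerivWithinAt F (f x) (Ici x) x)
    (hPc : Continuous P) (hP0 : ∀ x, 0 ≤ x → 0 ≤ P x) (hPX : 0 < P X)
    (hP' : ∀ x, 0 < x → HasDerivWithinAt P (f x ^ p) (Ici x) x)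
    (hGc : Continuous G) (hG0 : G 0 = 0) (hGX : 0 < G X)
    (hG' : ∀ x, 0 < x → HasDerivAt G (F x ^ q * x ^ (r - q)) x)
    (hFα : ∀ x ∈ Ioc (0 : ℝ) 1, F x = α * x)
    (hGβ : ∀ x ∈ Ioc (0 : ℝ) 1, β * x ^ (r + 1) ≤ G x) :
    (q - r - 1) * G X ≤ (r / eulerBeta (1 / r) ((q - 1) / r)) ^ r * P X ^ (q / p) := by
  have hq0 : 0 < q := by rw [hq]; positivity
  have hp1 : 0 < p - 1 := by linarith
  have hc : 0 < q - r - 1 := by rw [hq]; nlinarith [mul_pos hp1 hr]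
  set B := eulerBeta (1 / r) ((q - 1) / r) with hB
  have hB0 : 0 < B := eulerBeta_pos (by positivity) (div_pos (by linarith) hr)
  have key : ∀ Y, 0 < Y → (q - r - 1) * (blissJ q r Y + blissH q r Y) * G X ^ (1 / q) ≤
      (q - r) * P X ^ (1 / p) * blissJ q r Y ^ (1 - 1 / p) * blissH q r Y ^ (1 / q) := by
    intro Y hY
    refine bliss_transport_optimal hp hr hq hGX hPX (blissJ_pos hr q hY) (blissH_pos hr q hY)
      fun μ hμ => ?_
    exact bliss_transport hp hr hq hX hY hβ hμ hf hFc hFpos hF' hPc hP0 hP' hGc hG0 hG' hFα hGβ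
      (by field_simp)
  -- Letting `Y` tend to infinity uses the whole mass of the extremal and produces the complete beta
  -- integral.
  have tJ := tendsto_blissJ hr (q := q) (by linarith)
  have tH := tendsto_blissH hr (q := q) (by linarith)
  rw [← hB] at tJ tH
  have hBr : B / r ≠ 0 := by positivity
  have hBrc : B / r / (q - r - 1) ≠ 0 := by positivity
  have hlim := le_of_tendsto_of_tendsto (((tJ.add tH).const_mul (q - r - 1)).mul_const (G X ^ (1 / q)))
    (((tJ.rpow_const (p := 1 - 1 / p) (Or.inl hBr)).const_mul ((q - r) * P X ^ (1 / p))).mul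
      (tH.rpow_const (p := 1 / q) (Or.inl hBrc)))
    (by filter_upwards [Filter.eventually_gt_atTop 0] with Y hY using key Y hY)
  set K := B / r with hK
  have hK0 : 0 < K := by positivity
  have hqr : 0 < q - r := by linarith
  have e1 : (q - r - 1) * (K + K / (q - r - 1)) = (q - r) * K := by field_simp; ring
  rw [e1] at hlim
  have h2 : K * G X ^ (1 / q) ≤ P X ^ (1 / p) * (K ^ (1 - 1 / p) * (K / (q - r - 1)) ^ (1 / q)) := by
    refine le_of_mul_le_mul_left ?_ hqr
    linear_combination hlim
  have h3 := Real.rpow_le_rpow (by positivity) h2 hq0.le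
  have hrK : r / B = K⁻¹ := by rw [hK, inv_div]
  rw [hrK]
  have hPX' := hPX
  generalize P X = P at h3 hPX' ⊢
  generalize G X = G at h3 hGX ⊢
  generalize hcc : q - r - 1 = c at h3 hc ⊢
  have e2 : (K * G ^ (1 / q)) ^ q = K ^ q * G := by
    rw [Real.mul_rpow (by positivity) (by positivity), ← Real.rpow_mul hGX.le,
      one_div_mul_cancel hq0.ne', Real.rpow_one]
  have e3 : (P ^ (1 / p) * (K ^ (1 - 1 / p) * (K / c) ^ (1 / q))) ^ q =
      K ^ q * (K⁻¹ ^ r * P ^ (q / p)) / c := by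
    obtain ⟨P, rfl⟩ : ∃ s, Real.exp s = P := ⟨_, Real.exp_log hPX'⟩
    obtain ⟨K, hK⟩ : ∃ s, Real.exp s = K := ⟨_, Real.exp_log hK0⟩
    obtain ⟨c, rfl⟩ : ∃ s, Real.exp s = c := ⟨_, Real.exp_log hc⟩
    rw [← hK]
    simp only [← Real.exp_mul, ← Real.exp_sub, ← Real.exp_add, ← Real.exp_neg]
    congr 1
    rw [hq]
    field_simp
    ring
  rw [e2, e3, le_div_iff₀ hc] at h3
  refine le_of_mul_le_mul_left ?_ (show 0 < K ^ q by positivity)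
  linear_combination h3

/-! ### Step functions and their primitives -/

/-- The continuous function that vanishes for `x ≤ i`, equals `1` for `x ≥ i + 1` and is affine in
between. -/
noncomputable def unitRamp (i : ℕ) (x : ℝ) : ℝ := max 0 (min 1 (x - i))

theorem continuous_unitRamp (i : ℕ) : Continuous (unitRamp i) := by
  unfold unitRamp; fun_prop

theorem monotone_unitRamp (i : ℕ) : Monotone (unitRamp i) := fun x y h => by
  unfold unitRamp; gcongr

theorem unitRamp_nonneg (i : ℕ) (x : ℝ) : 0 ≤ unitRamp i x := le_max_left _ _

theorem unitRamp_of_le {i : ℕ} {x : ℝ} (h : x ≤ i) : unitRamp i x = 0 := by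
  unfold unitRamp; exact max_eq_left ((min_le_right _ _).trans (by linarith))

theorem unitRamp_of_ge {i : ℕ} {x : ℝ} (h : (i : ℝ) + 1 ≤ x) : unitRamp i x = 1 := by
  unfold unitRamp; rw [min_eq_left (by linarith), max_eq_right zero_le_one]

theorem unitRamp_of_mem {i : ℕ} {x : ℝ} (h : x ∈ Icc (i : ℝ) (i + 1)) : unitRamp i x = x - i := by
  unfold unitRamp; rw [min_eq_right (by linarith [h.2]), max_eq_right (by linarith [h.1])]

/-- Right derivatives exist at the corners too, and the half-open cells of the floor function select
the correct value there. -/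
theorem hasDerivWithinAt_unitRamp (i : ℕ) {x : ℝ} (hx : 0 ≤ x) :
    HasDerivWithinAt (unitRamp i) (if ⌊x⌋₊ = i then 1 else 0) (Ici x) x := by
  split_ifs with h
  · rw [Nat.floor_eq_iff hx] at h
    have hd : HasDerivWithinAt (fun y : ℝ => y - i) 1 (Ici x) x :=
      ((hasDerivAt_id x).sub_const _).hasDerivWithinAt
    refine hd.congr_of_eventuallyEq ?_ (unitRamp_of_mem ⟨h.1, h.2.le⟩)
    filter_upwards [self_mem_nhdsWithin, mem_nhdsWithin_of_mem_nhds (gt_mem_nhds h.2)] with y h1 h2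
    exact unitRamp_of_mem ⟨h.1.trans h1, h2.le⟩
  · rcases lt_or_ge x i with h1 | h1
    · refine (hasDerivWithinAt_const x (Ici x) (0 : ℝ)).congr_of_eventuallyEq ?_
        (unitRamp_of_le h1.le)
      filter_upwards [mem_nhdsWithin_of_mem_nhds (gt_mem_nhds h1)] with y hy
      exact unitRamp_of_le hy.le
    · have h2 : (i : ℝ) + 1 ≤ x := by
        by_contra h2
        exact h ((Nat.floor_eq_iff hx).2 ⟨h1, not_le.1 h2⟩)
      refine (hasDerivWithinAt_const x (Ici x) (1 : ℝ)).congr_of_eventuallyEq ?_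
        (unitRamp_of_ge h2)
      filter_upwards [self_mem_nhdsWithin] with y hy
      exact unitRamp_of_ge (h2.trans hy)

/-- The primitive of the step function with the value `a i` on `[i, i + 1)` for `i < N`, and `0`
elsewhere. -/
noncomputable def stepPrimitive (a : ℕ → ℝ) (N : ℕ) (x : ℝ) : ℝ :=
  ∑ i ∈ Finset.range N, a i * unitRamp i x

section
variable {a : ℕ → ℝ} {N : ℕ}

theorem continuous_stepPrimitive (a : ℕ → ℝ) (N : ℕ) : Continuous (stepPrimitive a N) :=
  continuous_finsetSum _ fun i _ => continuous_const.mul (continuous_unitRamp i)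

theorem monotone_stepPrimitive (ha : ∀ i, 0 ≤ a i) (N : ℕ) : Monotone (stepPrimitive a N) :=
  fun _ _ h => Finset.sum_le_sum fun i _ =>
    mul_le_mul_of_nonneg_left (monotone_unitRamp i h) (ha i)

theorem stepPrimitive_nonneg (ha : ∀ i, 0 ≤ a i) (N : ℕ) (x : ℝ) : 0 ≤ stepPrimitive a N x :=
  Finset.sum_nonneg fun i _ => mul_nonneg (ha i) (unitRamp_nonneg i x)

theorem hasDerivWithinAt_stepPrimitive (a : ℕ → ℝ) (N : ℕ) {x : ℝ} (hx : 0 ≤ x) :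
    HasDerivWithinAt (stepPrimitive a N) (if ⌊x⌋₊ < N then a ⌊x⌋₊ else 0) (Ici x) x := by
  have h := HasDerivWithinAt.fun_sum (u := Finset.range N) fun i _ =>
    (hasDerivWithinAt_unitRamp i hx).const_mul (a i)
  convert! h using 1
  simp [Finset.sum_ite_eq]

theorem stepPrimitive_of_mem (a : ℕ → ℝ) (N : ℕ) {x : ℝ} (hx : x ∈ Icc (0 : ℝ) 1) :
    stepPrimitive a (N + 1) x = a 0 * x := by
  rw [stepPrimitive, Finset.sum_range_succ', Finset.sum_eq_zero, zero_add, unitRamp_of_mem]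
  · simp
  · simpa using hx
  · intro i _
    rw [unitRamp_of_le, mul_zero]
    push_cast
    have : (0 : ℝ) ≤ i := by positivity
    linarith [hx.2]

theorem stepPrimitive_of_ge (a : ℕ → ℝ) {x : ℝ} (hx : (N : ℝ) ≤ x) :
    stepPrimitive a N x = ∑ i ∈ Finset.range N, a i := by
  refine Finset.sum_congr rfl fun i hi => ?_
  rw [unitRamp_of_ge, mul_one]
  have : ((i + 1 : ℕ) : ℝ) ≤ N := by exact_mod_cast Finset.mem_range.1 hi
  push_cast at this
  linarith

theorem sum_range_le_stepPrimitive (ha : ∀ i, 0 ≤ a i) {m : ℕ} (hm : m ≤ N) {x : ℝ}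
    (hx : (m : ℝ) ≤ x) : ∑ i ∈ Finset.range m, a i ≤ stepPrimitive a N x := by
  rw [← stepPrimitive_of_ge a hx]
  exact Finset.sum_le_sum_of_subset_of_nonneg (Finset.range_mono hm) fun i _ _ =>
    mul_nonneg (ha i) (unitRamp_nonneg i x)

theorem stepPrimitive_pos (ha : ∀ i, 0 ≤ a i) (ha0 : 0 < a 0) (N : ℕ) {x : ℝ} (hx : 0 < x) :
    0 < stepPrimitive a (N + 1) x := by
  have h : 0 < min x 1 := lt_min hx one_pos
  refine lt_of_lt_of_le ?_ (monotone_stepPrimitive ha _ (min_le_left x 1))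
  rw [stepPrimitive_of_mem a N ⟨h.le, min_le_right _ _⟩]
  positivity

end

/-- Bliss's inequality for step functions. -/
theorem bliss_step {p q r : ℝ} (hp : 1 < p) (hr : 0 < r) (hq : q = p * (1 + r)) {a : ℕ → ℝ}
    (ha : ∀ i, 0 < a i) (M : ℕ) :
    ∃ G : ℝ → ℝ, (∀ x, 0 ≤ x → 0 ≤ G x) ∧
      (∀ x, 0 < x → HasDerivAt G (stepPrimitive a (M + 1) x ^ q * x ^ (r - q)) x) ∧
      ∀ X, (M + 1 : ℝ) ≤ X → (q - r - 1) * G X ≤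
        (r / eulerBeta (1 / r) ((q - 1) / r)) ^ r *
          (∑ i ∈ Finset.range (M + 1), a i ^ p) ^ (q / p) := by
  have hq0 : 0 < q := by rw [hq]; positivity
  have ha' : ∀ i, 0 ≤ a i := fun i => (ha i).le
  set F := stepPrimitive a (M + 1) with hF
  have hFc : Continuous F := continuous_stepPrimitive _ _
  have hFpos : ∀ x, 0 < x → 0 < F x := fun x hx => stepPrimitive_pos ha' (ha 0) M hx
  -- On `(0, 1]` one has `F t = a 0 * t`, so `F t ^ q * t ^ (r - q) = a 0 ^ q * t ^ r`. Splitting at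
  -- 1 with `min` and `max` gives a continuous extension through 0, whose primitive is
  -- differentiable everywhere.
  set k : ℝ → ℝ := fun t => (min t 1) ^ r * F (max t 1) ^ q * (max t 1) ^ (r - q) with hk
  have hkc : Continuous k := by
    refine Continuous.mul (Continuous.mul ?_ ?_) ?_
    · exact (continuous_id.min continuous_const).rpow_const fun _ => Or.inr hr.le
    · exact (hFc.comp (continuous_id.max continuous_const)).rpow_const fun _ => Or.inr hq0.le
    · exact (continuous_id.max continuous_const).rpow_const fun t =>
        Or.inl (lt_of_lt_of_le one_pos (le_max_right t 1)).ne'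
  have hk1 : ∀ t ∈ Icc (0 : ℝ) 1, k t = t ^ r * a 0 ^ q := by
    intro t ht
    simp only [hk]
    rw [min_eq_left ht.2, max_eq_right ht.2, hF, stepPrimitive_of_mem a M ⟨zero_le_one, le_rfl⟩]
    simp
  have hkF : ∀ t, 0 < t → k t = F t ^ q * t ^ (r - q) := by
    intro t ht
    rcases le_total t 1 with h | h
    · rw [hk1 t ⟨ht.le, h⟩, hF, stepPrimitive_of_mem a M ⟨ht.le, h⟩, Real.mul_rpow (ha' 0) ht.le,
        mul_assoc, ← Real.rpow_add ht, add_sub_cancel, mul_comm]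
    · simp only [hk]
      rw [min_eq_right h, max_eq_left h, Real.one_rpow, one_mul]
  set G : ℝ → ℝ := fun x => ∫ t in (0 : ℝ)..x, k t with hG
  have hGd : ∀ x, HasDerivAt G (k x) x := fun x =>
    (hkc.integral_hasStrictDerivAt 0 x).hasDerivAt
  have hk0 : ∀ t, 0 ≤ t → 0 ≤ k t := fun t ht => by
    have h1 : 0 ≤ min t 1 := le_min ht zero_le_one
    have h2 : 0 < max t 1 := lt_of_lt_of_le one_pos (le_max_right t 1)
    have := hFpos _ h2
    simp only [hk]
    positivity
  have hGnn : ∀ x, 0 ≤ x → 0 ≤ G x := fun x hx =>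
    intervalIntegral.integral_nonneg hx fun t ht => hk0 t ht.1
  have hGc : Continuous G := continuous_iff_continuousAt.2 fun x => (hGd x).continuousAt
  have hG1 : ∀ x ∈ Ioc (0 : ℝ) 1, a 0 ^ q / (r + 1) * x ^ (r + 1) ≤ G x := by
    intro x hx
    refine le_of_eq ?_
    have h1 : G x = ∫ t in (0 : ℝ)..x, t ^ r * a 0 ^ q := by
      refine intervalIntegral.integral_congr fun t ht => ?_
      rw [uIcc_of_le hx.1.le] at ht
      exact hk1 t ⟨ht.1, ht.2.trans hx.2⟩
    rw [h1, intervalIntegral.integral_mul_const, integral_rpow (Or.inl (by linarith)),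
      Real.zero_rpow (by linarith)]
    ring
  refine ⟨G, hGnn, fun x hx => hkF x hx ▸ hGd x, fun X hX => ?_⟩
  have hX0 : 0 < X := lt_of_lt_of_le (by positivity) hX
  have hGX : 0 < G X := by
    have h1 : StrictMonoOn G (Ici 0) := by
      refine strictMonoOn_of_deriv_pos (convex_Ici 0) hGc.continuousOn fun x hx => ?_
      rw [interior_Ici] at hx
      have hx : 0 < x := hx
      rw [(hGd x).deriv, hkF x hx]
      have := hFpos x hx
      positivity
    have h2 := h1 self_mem_Ici (hX0.le : (0 : ℝ) ≤ X) hX0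
    rwa [show G 0 = 0 by simp [hG]] at h2
  have hap : ∀ i, 0 ≤ a i ^ p := fun i => Real.rpow_nonneg (ha' i) p
  have h := bliss_inequality hp hr hq (F := F) (P := stepPrimitive (fun i => a i ^ p) (M + 1))
    (f := fun x => if ⌊x⌋₊ < M + 1 then a ⌊x⌋₊ else 0) (G := G) (X := X) (α := a 0)
    (β := a 0 ^ q / (r + 1)) hX0 (by have := ha 0; positivity)
    (fun x => by split_ifs; exacts [ha' _, le_rfl]) hFc hFpos
    (fun x hx => hasDerivWithinAt_stepPrimitive _ _ hx.le) (continuous_stepPrimitive _ _)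
    (fun x _ => stepPrimitive_nonneg hap _ x)
    (stepPrimitive_pos hap (Real.rpow_pos_of_pos (ha 0) p) M hX0)
    (fun x hx => by
      convert! hasDerivWithinAt_stepPrimitive (fun i => a i ^ p) (M + 1) hx.le using 1
      split_ifs
      · rfl
      · exact Real.zero_rpow (by linarith))
    hGc (by simp [hG]) hGX (fun x hx => hkF x hx ▸ hGd x)
    (fun x hx => stepPrimitive_of_mem a M ⟨hx.1.le, hx.2⟩) hG1
  rwa [stepPrimitive_of_ge (N := M + 1) _ (by push_cast; exact hX)] at h

/-! ### Discrete Bliss inequality and change of weights -/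

/-- Summation by parts against a nonnegative weight. -/
theorem sum_by_parts_nonneg {s δ : ℕ → ℝ} (hs : Monotone s) (hs0 : 0 ≤ s 0) (hδ : ∀ n, 0 ≤ δ n)
    (M : ℕ) : 0 ≤ ∑ j ∈ Finset.range M, s j * (δ j - δ (j + 1)) + s M * δ M := by
  induction M with
  | zero => simpa using mul_nonneg hs0 (hδ 0)
  | succ M ih =>
    rw [Finset.sum_range_succ]
    have := mul_nonneg (sub_nonneg.2 (hs (Nat.le_succ M))) (hδ (M + 1))
    simp only [Nat.succ_eq_add_one] at this
    linarith

/-- The discrete form of Bliss's inequality. -/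
theorem bliss_sum {p q r : ℝ} (hp : 1 < p) (hr : 0 < r) (hq : q = p * (1 + r)) {a : ℕ → ℝ}
    (ha : ∀ i, 0 < a i) (M : ℕ) :
    ∑ j ∈ Finset.range M, (∑ i ∈ Finset.range (j + 1), a i) ^ q *
        ((j + 1 : ℝ) ^ (-(q - r - 1)) - (j + 2 : ℝ) ^ (-(q - r - 1))) +
      (∑ i ∈ Finset.range (M + 1), a i) ^ q * (M + 1 : ℝ) ^ (-(q - r - 1)) ≤
      (r / eulerBeta (1 / r) ((q - 1) / r)) ^ r *
        (∑ i ∈ Finset.range (M + 1), a i ^ p) ^ (q / p) := by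
  have hq0 : 0 < q := by rw [hq]; positivity
  have hp1 : 0 < p - 1 := by linarith
  have hc : 0 < q - r - 1 := by rw [hq]; nlinarith [mul_pos hp1 hr]
  have ha' : ∀ i, 0 ≤ a i := fun i => (ha i).le
  obtain ⟨G, hG0, hG', hGle⟩ := bliss_step hp hr hq ha M
  set c := q - r - 1 with hcdef
  -- Past `m + 1` the primitive is at least the partial sum of length `m + 1`. Since `c * G' = c * F
  -- ^ q * x ^ (-c - 1)`, the function `c * G + S * x ^ (-c)` is nondecreasing there.
  have hstep : ∀ m : ℕ, m ≤ M → ∀ u v : ℝ, (m + 1 : ℝ) ≤ u → u ≤ v →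
      c * G u + (∑ i ∈ Finset.range (m + 1), a i) ^ q * (u ^ (-c) - v ^ (-c)) ≤ c * G v := by
    intro m hm u v hu huv
    set S := (∑ i ∈ Finset.range (m + 1), a i) ^ q with hS
    have hd : ∀ x, 0 < x → HasDerivAt (fun x => c * G x + S * x ^ (-c))
        (c * (stepPrimitive a (M + 1) x ^ q * x ^ (r - q)) + S * (-c * x ^ (-c - 1))) x :=
      fun x hx => ((hG' x hx).const_mul c).add
        ((Real.hasDerivAt_rpow_const (Or.inl hx.ne')).const_mul S)
    have hpos : ∀ x : ℝ, (m + 1 : ℝ) ≤ x → 0 < x := fun x hx => lt_of_lt_of_le (by positivity) hx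
    have hmono : MonotoneOn (fun x => c * G x + S * x ^ (-c)) (Ici (m + 1 : ℝ)) := by
      refine monotoneOn_of_deriv_nonneg (convex_Ici _)
        (fun x hx => (hd x (hpos x hx)).continuousAt.continuousWithinAt)
        (fun x hx => (hd x (hpos x (interior_subset hx))).differentiableAt.differentiableWithinAt)
        fun x hx => ?_
      have hx1 : (m + 1 : ℝ) ≤ x := interior_subset hx
      have hx0 := hpos x hx1
      rw [(hd x hx0).deriv, show -c - 1 = r - q by rw [hcdef]; ring]
      have hSF : S ≤ stepPrimitive a (M + 1) x ^ q :=
        Real.rpow_le_rpow (Finset.sum_nonneg fun i _ => ha' i)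
          (sum_range_le_stepPrimitive ha' (by omega) (by push_cast; exact hx1)) hq0.le
      have := mul_nonneg (mul_nonneg hc.le (Real.rpow_nonneg hx0.le (r - q))) (sub_nonneg.2 hSF)
      linarith
    have := hmono hu (hu.trans huv : (m + 1 : ℝ) ≤ v) huv
    dsimp only at this
    linarith
  have hsum : ∀ m : ℕ, m ≤ M → ∑ j ∈ Finset.range m, (∑ i ∈ Finset.range (j + 1), a i) ^ q *
        ((j + 1 : ℝ) ^ (-c) - (j + 2 : ℝ) ^ (-c)) ≤ c * G (m + 1) := by
    intro m
    induction m with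
    | zero => intro _; simpa using mul_nonneg hc.le (hG0 1 zero_le_one)
    | succ m ih =>
      intro hm
      rw [Finset.sum_range_succ]
      have h1 := ih (by omega)
      have h2 := hstep m (by omega) (m + 1) (m + 2) le_rfl (by linarith)
      push_cast
      rw [show (m : ℝ) + 1 + 1 = m + 2 by ring]
      linarith
  set A := ∑ j ∈ Finset.range M, (∑ i ∈ Finset.range (j + 1), a i) ^ q *
        ((j + 1 : ℝ) ^ (-c) - (j + 2 : ℝ) ^ (-c))
  set S := (∑ i ∈ Finset.range (M + 1), a i) ^ q
  -- The limit `X → ∞` retains the full tail term, which later absorbs the boundary term of the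
  -- summation by parts.
  have hlim : Filter.Tendsto (fun X : ℝ => A + S * ((M + 1 : ℝ) ^ (-c) - X ^ (-c))) Filter.atTop
      (nhds (A + S * ((M + 1 : ℝ) ^ (-c) - 0))) :=
    ((tendsto_const_nhds.sub (tendsto_rpow_neg_atTop hc)).const_mul S).const_add A
  rw [sub_zero] at hlim
  refine le_of_tendsto hlim ?_
  filter_upwards [Filter.eventually_ge_atTop (M + 1 : ℝ)] with X hX
  have h1 := hstep M le_rfl (M + 1) X le_rfl hX
  linarith [hsum M le_rfl, hGle X hX]

/-- The weights `n ^ (-(q - 1))` have smaller tails than the ones in Bliss's inequality. -/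
theorem hardy_mixed_sum_of_pos {p q r : ℝ} (hp : 1 < p) (hr : 0 < r) (hq : q = p * (1 + r))
    {a : ℕ → ℝ} (ha : ∀ i, 0 < a i) (M : ℕ) :
    ∑ j ∈ Finset.range M, (∑ i ∈ Finset.range (j + 1), a i) ^ q *
        ((j + 1 : ℝ) ^ (1 - q) - (j + 2 : ℝ) ^ (1 - q)) ≤
      (r / eulerBeta (1 / r) ((q - 1) / r)) ^ r *
        (∑ i ∈ Finset.range (M + 1), a i ^ p) ^ (q / p) := by
  have hq0 : 0 < q := by rw [hq]; positivity
  have ha' : ∀ i, 0 ≤ a i := fun i => (ha i).le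
  refine le_trans ?_ (bliss_sum hp hr hq ha M)
  have hs : ∀ n, 0 ≤ ∑ i ∈ Finset.range n, a i := fun n => Finset.sum_nonneg fun i _ => ha' i
  -- The weight `δ` is the difference of the two tails, nonnegative because `-(q - r - 1) ≥ 1 - q`
  -- and the base is at least 1.
  have h := sum_by_parts_nonneg (s := fun j => (∑ i ∈ Finset.range (j + 1), a i) ^ q)
    (δ := fun j => (j + 1 : ℝ) ^ (-(q - r - 1)) - (j + 1 : ℝ) ^ (1 - q))
    (fun m n hmn => Real.rpow_le_rpow (hs _) (Finset.sum_le_sum_of_subset_of_nonneg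
      (Finset.range_mono (by omega)) fun i _ _ => ha' i) hq0.le)
    (Real.rpow_nonneg (hs _) q)
    (fun n => sub_nonneg.2 (Real.rpow_le_rpow_of_exponent_le
      (le_add_of_nonneg_left (by positivity)) (by linarith))) M
  have h2 : 0 ≤ (∑ i ∈ Finset.range (M + 1), a i) ^ q * (M + 1 : ℝ) ^ (1 - q) :=
    mul_nonneg (Real.rpow_nonneg (hs _) q) (by positivity)
  have e : ∑ j ∈ Finset.range M, (∑ i ∈ Finset.range (j + 1), a i) ^ q *
        ((j + 1 : ℝ) ^ (-(q - r - 1)) - (j + 2 : ℝ) ^ (-(q - r - 1))) =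
      ∑ j ∈ Finset.range M, (∑ i ∈ Finset.range (j + 1), a i) ^ q *
        ((j + 1 : ℝ) ^ (1 - q) - (j + 2 : ℝ) ^ (1 - q)) +
      ∑ j ∈ Finset.range M, (∑ i ∈ Finset.range (j + 1), a i) ^ q *
        ((j + 1 : ℝ) ^ (-(q - r - 1)) - (j + 1 : ℝ) ^ (1 - q) -
          (((j + 1 : ℕ) + 1 : ℝ) ^ (-(q - r - 1)) - ((j + 1 : ℕ) + 1 : ℝ) ^ (1 - q))) := by
    rw [← Finset.sum_add_distrib]
    refine Finset.sum_congr rfl fun j _ => ?_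
    push_cast
    rw [show (j : ℝ) + 1 + 1 = j + 2 by ring]
    ring
  rw [e]
  linarith

/-- Vanishing terms are handled by adding `ε > 0` to every term and letting `ε` tend to 0; both
sides are continuous in `ε`. -/
theorem hardy_mixed_sum {p q r : ℝ} (hp : 1 < p) (hr : 0 < r) (hq : q = p * (1 + r))
    {a : ℕ → ℝ} (ha : ∀ i, 0 ≤ a i) (M : ℕ) :
    ∑ j ∈ Finset.range M, (∑ i ∈ Finset.range (j + 1), a i) ^ q *
        ((j + 1 : ℝ) ^ (1 - q) - (j + 2 : ℝ) ^ (1 - q)) ≤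
      (r / eulerBeta (1 / r) ((q - 1) / r)) ^ r *
        (∑ i ∈ Finset.range (M + 1), a i ^ p) ^ (q / p) := by
  have hq0 : 0 < q := by rw [hq]; positivity
  have hp0 : 0 < p := by linarith
  have hl : Continuous fun ε : ℝ => ∑ j ∈ Finset.range M,
      (∑ i ∈ Finset.range (j + 1), (a i + ε)) ^ q *
        ((j + 1 : ℝ) ^ (1 - q) - (j + 2 : ℝ) ^ (1 - q)) := by
    refine continuous_finsetSum _ fun j _ => Continuous.mul ?_ continuous_const
    exact (continuous_finsetSum _ fun i _ => continuous_const.add continuous_id).rpow_const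
      fun _ => Or.inr hq0.le
  have hr' : Continuous fun ε : ℝ => (r / eulerBeta (1 / r) ((q - 1) / r)) ^ r *
        (∑ i ∈ Finset.range (M + 1), (a i + ε) ^ p) ^ (q / p) := by
    refine continuous_const.mul (Continuous.rpow_const ?_ fun _ => Or.inr (by positivity))
    exact continuous_finsetSum _ fun i _ =>
      (continuous_const.add continuous_id).rpow_const fun _ => Or.inr hp0.le
  have h := le_of_tendsto_of_tendsto ((hl.tendsto 0).mono_left nhdsWithin_le_nhds)
    ((hr'.tendsto 0).mono_left (nhdsWithin_le_nhds (s := Ioi 0)))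
    (Filter.eventually_of_mem self_mem_nhdsWithin fun ε (hε : 0 < ε) =>
      hardy_mixed_sum_of_pos hp hr hq (fun i => add_pos_of_nonneg_of_pos (ha i) hε) M)
  simpa using h

/-! ### Admissible constants for the mixed inequality -/

theorem ofReal_inv_rpow {x : ℝ} (hx : 0 < x) (q : ℝ) :
    (ENNReal.ofReal x)⁻¹ ^ q = ENNReal.ofReal (x ^ (-q)) := by
  rw [ENNReal.inv_rpow, ENNReal.ofReal_rpow_of_pos hx, Real.rpow_neg hx.le,
    ENNReal.ofReal_inv_of_pos (by positivity)]

theorem lintegral_Ioc_inv_rpow {q u v : ℝ} (hq : 1 < q) (hu : 0 < u) (huv : u ≤ v) :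
    ∫⁻ x in Ioc u v, (ENNReal.ofReal x)⁻¹ ^ q =
      ENNReal.ofReal ((u ^ (1 - q) - v ^ (1 - q)) / (q - 1)) := by
  have h0 : (0 : ℝ) ∉ uIcc u v := notMem_uIcc_of_lt hu (hu.trans_le huv)
  have hi : IntervalIntegrable (fun x : ℝ => x ^ (-q)) volume u v :=
    intervalIntegral.intervalIntegrable_rpow (Or.inr h0)
  rw [setLIntegral_congr_fun measurableSet_Ioc
      (fun x hx => ofReal_inv_rpow (hu.trans hx.1) q),
    ← ofReal_integral_eq_lintegral_ofReal
      ((intervalIntegrable_iff_integrableOn_Ioc_of_le huv).1 hi)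
      (ae_restrict_of_forall_mem measurableSet_Ioc fun x hx =>
        Real.rpow_nonneg (hu.trans hx.1).le _),
    ← intervalIntegral.integral_of_le huv,
    integral_rpow (Or.inr ⟨by linarith, h0⟩), ← neg_div_neg_eq]
  congr 2 <;> ring_nf

theorem lintegral_Ioi_inv_rpow {q : ℝ} (hq : 1 < q) :
    ∫⁻ x in Ioi (1 : ℝ), (ENNReal.ofReal x)⁻¹ ^ q = ENNReal.ofReal ((q - 1)⁻¹) := by
  rw [setLIntegral_congr_fun measurableSet_Ioi
      (fun x hx => ofReal_inv_rpow (one_pos.trans hx) q),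
    ← ofReal_integral_eq_lintegral_ofReal
      (integrableOn_Ioi_rpow_of_lt (by linarith) one_pos)
      (ae_restrict_of_forall_mem measurableSet_Ioi fun x hx =>
        Real.rpow_nonneg (one_pos.trans hx).le _),
    integral_Ioi_rpow_of_lt (by linarith) one_pos, ← neg_div_neg_eq]
  congr 1
  rw [Real.one_rpow, neg_neg, one_div]
  congr 1
  ring

/-- The integral in the mixed Hardy inequality as a series. -/
theorem lintegral_mixed_eq_tsum {q : ℝ} (hq : 1 < q) (f : ℕ → ℝ≥0) :
    ∫⁻ x in Ioi (1 : ℝ),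
        ((ENNReal.ofReal x)⁻¹ * ∑ n ∈ Finset.Ico 1 ⌈x⌉₊, (f n : ℝ≥0∞)) ^ q =
      ∑' n : ℕ, (∑ i ∈ Finset.range (n + 1), (f (i + 1) : ℝ≥0∞)) ^ q *
        ∫⁻ x in Ioc ((n + 1 : ℕ) : ℝ) ((n + 2 : ℕ) : ℝ), (ENNReal.ofReal x)⁻¹ ^ q := by
  rw [lintegral_Ioi_one_eq_tsum]
  refine tsum_congr fun n => ?_
  rw [← lintegral_const_mul' _ _ (ENNReal.rpow_ne_top_of_nonneg (by linarith) (by simp))]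
  refine setLIntegral_congr_fun measurableSet_Ioc fun x hx => ?_
  -- On `(n + 1, n + 2]` the inner sum runs over the indices 1 to `n + 1`, so it is constant.
  have hc : ⌈x⌉₊ = n + 2 := by
    rw [Nat.ceil_eq_iff (by omega)]
    exact ⟨by simpa using hx.1, hx.2⟩
  rw [hc, ENNReal.mul_rpow_of_nonneg _ _ (by linarith), mul_comm, Finset.sum_Ico_eq_sum_range]
  simp only [Nat.add_one_sub_one, add_comm 1]

/-- On `(n + 1, n + 2]` one has `1 / x ≤ 1 / (n + 1)`, so the integral is dominated by the series in
`hardy_tsum`. -/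
theorem toNNReal_mem_mixedHardyConstants_self {p : ℝ} (hp : 1 < p) :
    Real.toNNReal (p / (p - 1)) ∈ mixedHardyConstants p p := by
  have hp1 : 0 < p - 1 := by linarith
  intro f
  rw [lintegral_mixed_eq_tsum hp]
  have h : ∑' n : ℕ, (∑ i ∈ Finset.range (n + 1), (f (i + 1) : ℝ≥0∞)) ^ p *
        ∫⁻ x in Ioc ((n + 1 : ℕ) : ℝ) ((n + 2 : ℕ) : ℝ), (ENNReal.ofReal x)⁻¹ ^ p ≤
      ENNReal.ofReal ((p / (p - 1)) ^ p) * ∑' n, (f (n + 1) : ℝ≥0∞) ^ p := by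
    refine le_trans (ENNReal.tsum_le_tsum fun n => ?_)
      (hardy_tsum hp fun n => (f (n + 1) : ℝ≥0∞))
    rw [mul_comm (((n + 1 : ℕ) : ℝ≥0∞)⁻¹), ENNReal.mul_rpow_of_nonneg _ _ (by linarith)]
    gcongr
    calc _ ≤ ∫⁻ _ in Ioc ((n + 1 : ℕ) : ℝ) ((n + 2 : ℕ) : ℝ), ((n + 1 : ℕ) : ℝ≥0∞)⁻¹ ^ p := by
          refine setLIntegral_mono measurable_const fun x hx => ?_
          refine ENNReal.rpow_le_rpow (ENNReal.inv_le_inv.2 ?_) (by linarith)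
          rw [← ENNReal.ofReal_natCast]
          exact ENNReal.ofReal_le_ofReal hx.1.le
      _ = _ := by
          rw [setLIntegral_const, Real.volume_Ioc]
          push_cast
          rw [show (n : ℝ) + 2 - (n + 1) = 1 by ring, ENNReal.ofReal_one, mul_one]
  refine (ENNReal.rpow_le_rpow h (by positivity)).trans_eq ?_
  rw [ENNReal.mul_rpow_of_nonneg _ _ (by positivity),
    ENNReal.ofReal_rpow_of_nonneg (by positivity) (by positivity),
    ← Real.rpow_mul (by positivity), mul_one_div_cancel (by linarith), Real.rpow_one]
  rfl

theorem toNNReal_mem_mixedHardyConstants {p q r : ℝ} (hp : 1 < p) (hr : 0 < r)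
    (hq : q = p * (1 + r)) :
    Real.toNNReal (((r / eulerBeta (1 / r) ((q - 1) / r)) ^ r / (q - 1)) ^ (1 / q)) ∈
      mixedHardyConstants p q := by
  have hp1 : 0 < p - 1 := by linarith
  have hq1 : 1 < q := by rw [hq]; nlinarith
  have hq0 : 0 < q - 1 := by linarith
  have hB : 0 < eulerBeta (1 / r) ((q - 1) / r) := eulerBeta_pos (by positivity) (by positivity)
  set C := (r / eulerBeta (1 / r) ((q - 1) / r)) ^ r with hC
  have hC0 : 0 < C := by positivity
  intro f
  rw [lintegral_mixed_eq_tsum hq1]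
  have h : ∑' n : ℕ, (∑ i ∈ Finset.range (n + 1), (f (i + 1) : ℝ≥0∞)) ^ q *
        ∫⁻ x in Ioc ((n + 1 : ℕ) : ℝ) ((n + 2 : ℕ) : ℝ), (ENNReal.ofReal x)⁻¹ ^ q ≤
      ENNReal.ofReal (C / (q - 1)) * (∑' n, (f (n + 1) : ℝ≥0∞) ^ p) ^ (q / p) := by
    refine ENNReal.tsum_le_of_sum_range_le fun M => ?_
    have hM := hardy_mixed_sum hp hr hq (a := fun i => (f (i + 1) : ℝ)) (fun i => by positivity) M
    have hM' := ENNReal.ofReal_le_ofReal (div_le_div_of_nonneg_right hM hq0.le)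
    have hw : ∀ j : ℕ, 0 ≤ (j + 1 : ℝ) ^ (1 - q) - (j + 2 : ℝ) ^ (1 - q) := fun j =>
      sub_nonneg.2 (Real.rpow_le_rpow_of_nonpos (by positivity) (by linarith) (by linarith))
    calc _ = ENNReal.ofReal ((∑ j ∈ Finset.range M,
          (∑ i ∈ Finset.range (j + 1), (f (i + 1) : ℝ)) ^ q *
            ((j + 1 : ℝ) ^ (1 - q) - (j + 2 : ℝ) ^ (1 - q))) / (q - 1)) := by
          rw [Finset.sum_div, ENNReal.ofReal_sum_of_nonneg fun j _ =>
            div_nonneg (mul_nonneg (by positivity) (hw j)) hq0.le]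
          refine Finset.sum_congr rfl fun j _ => ?_
          rw [lintegral_Ioc_inv_rpow hq1 (by positivity) (by push_cast; linarith), mul_div_assoc,
            ENNReal.ofReal_mul (by positivity),
            ← ENNReal.ofReal_rpow_of_nonneg (by positivity) (by linarith),
            ENNReal.ofReal_sum_of_nonneg (by intros; positivity)]
          push_cast
          simp
      _ ≤ _ := hM'
      _ = ENNReal.ofReal (C / (q - 1)) *
          (∑ n ∈ Finset.range (M + 1), (f (n + 1) : ℝ≥0∞) ^ p) ^ (q / p) := by
          rw [mul_div_right_comm, ENNReal.ofReal_mul (by positivity),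
            ← ENNReal.ofReal_rpow_of_nonneg (by positivity) (by positivity),
            ENNReal.ofReal_sum_of_nonneg (by intros; positivity)]
          congr 2
          refine Finset.sum_congr rfl fun n _ => ?_
          rw [← ENNReal.ofReal_rpow_of_nonneg (by positivity) (by linarith),
            ENNReal.ofReal_coe_nnreal]
      _ ≤ _ := by
          gcongr
          exact ENNReal.sum_le_tsum _
  refine (ENNReal.rpow_le_rpow h (by positivity)).trans_eq ?_
  rw [ENNReal.mul_rpow_of_nonneg _ _ (by positivity),
    ENNReal.ofReal_rpow_of_nonneg (by positivity) (by positivity), ← ENNReal.rpow_mul,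
    show q / p * (1 / q) = 1 / p by field_simp]
  rfl

/-! ### Lower bound and existence of the least constant -/

/-- The sequence `1, 0, 0, …` gives the lower bound. -/
theorem le_of_mem_mixedHardyConstants {p q : ℝ} (hp : 0 < p) (hq : 1 < q) {A : ℝ≥0}
    (hA : A ∈ mixedHardyConstants p q) : (q - 1) ^ (-1 / q) ≤ (A : ℝ) := by
  have hq0 : 0 < q - 1 := by linarith
  have h := hA (Pi.single 1 1)
  have h1 : ∫⁻ x in Ioi (1 : ℝ), ((ENNReal.ofReal x)⁻¹ *
      ∑ n ∈ Finset.Ico 1 ⌈x⌉₊, ((Pi.single 1 1 : ℕ → ℝ≥0) n : ℝ≥0∞)) ^ q =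
      ∫⁻ x in Ioi (1 : ℝ), (ENNReal.ofReal x)⁻¹ ^ q := by
    refine setLIntegral_congr_fun measurableSet_Ioi fun x hx => ?_
    have hx1 : 1 < ⌈x⌉₊ := Nat.lt_ceil.2 (by simpa using hx)
    rw [Finset.sum_eq_single_of_mem 1 (by simpa using hx1) fun n _ hn => by simp [hn]]
    simp
  have h2 : ∑' n : ℕ, ((Pi.single 1 1 : ℕ → ℝ≥0) (n + 1) : ℝ≥0∞) ^ p = 1 := by
    rw [tsum_eq_single 0 fun n hn => by simp [hn, hp]]
    simp
  rw [h1, h2, ENNReal.one_rpow, mul_one, lintegral_Ioi_inv_rpow hq,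
    ENNReal.ofReal_rpow_of_nonneg (by positivity) (by positivity)] at h
  have h3 := ENNReal.toReal_mono ENNReal.coe_ne_top h
  rw [ENNReal.toReal_ofReal (by positivity), ENNReal.coe_toReal] at h3
  rwa [neg_div, Real.rpow_neg hq0.le, ← Real.inv_rpow hq0.le]

theorem isLeast_sInf_mixedHardyConstants {p q : ℝ} (hp : 0 < p) (hq : 1 < q)
    (hne : (mixedHardyConstants p q).Nonempty) :
    IsLeast (mixedHardyConstants p q) (sInf (mixedHardyConstants p q)) := by
  have hq0 : 0 < q - 1 := by linarith
  set A := sInf (mixedHardyConstants p q) with hA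
  -- Positivity matters when the right-hand norm is infinite, since `0 * ⊤ = 0` in `ℝ≥0∞`.
  have hA0 : 0 < A := by
    have h : Real.toNNReal ((q - 1) ^ (-1 / q)) ≤ A := le_csInf hne fun B hB =>
      Real.toNNReal_le_iff_le_coe.2 (le_of_mem_mixedHardyConstants hp hq hB)
    exact lt_of_lt_of_le (Real.toNNReal_pos.2 (by positivity)) h
  refine ⟨fun f => ?_, fun B hB => csInf_le (OrderBot.bddBelow _) hB⟩
  set R := (∑' n : ℕ, (f (n + 1) : ℝ≥0∞) ^ p) ^ (1 / p) with hR
  have hmem : ∀ B ∈ mixedHardyConstants p q, _ ≤ (B : ℝ≥0∞) * R := fun B hB => hB f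
  set L := (∫⁻ x in Ioi (1 : ℝ),
        ((ENNReal.ofReal x)⁻¹ * ∑ n ∈ Finset.Ico 1 ⌈x⌉₊, (f n : ℝ≥0∞)) ^ q) ^ (1 / q)
  obtain ⟨B, hB⟩ := hne
  rcases eq_or_ne R ⊤ with hRt | hRt
  · rw [hRt, ENNReal.mul_top (by exact_mod_cast hA0.ne')]
    exact le_top
  rcases eq_or_ne R 0 with hR0 | hR0
  · simpa [hR0] using hmem B hB
  have hdiv : ∀ B ∈ mixedHardyConstants p q, L / R ≤ B := fun B hB =>
    ENNReal.div_le_of_le_mul (hmem B hB)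
  have hLR : L / R ≠ ⊤ := ne_top_of_le_ne_top ENNReal.coe_ne_top (hdiv B hB)
  -- For finite nonzero `R`, admissibility at `f` is the closed condition `L / R ≤ B`, so it passes
  -- to the infimum.
  have hle : (L / R).toNNReal ≤ A := le_csInf ⟨B, hB⟩ fun B hB =>
    by simpa using ENNReal.toNNReal_mono ENNReal.coe_ne_top (hdiv B hB)
  rw [← ENNReal.div_le_iff hR0 hRt, ← ENNReal.coe_toNNReal hLR]
  exact_mod_cast hle

theorem hardyFactor_mul_mem {p q : ℝ} (hp : 1 < p) (hpq : p ≤ q) :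
    0 ≤ hardyFactor q p * (q - 1) ^ (-1 / q) ∧
      Real.toNNReal (hardyFactor q p * (q - 1) ^ (-1 / q)) ∈ mixedHardyConstants p q := by
  have hp1 : 0 < p - 1 := by linarith
  have hq1 : 0 < q - 1 := by linarith
  rcases hpq.eq_or_lt with rfl | hlt
  · have e : hardyFactor p p * (p - 1) ^ (-1 / p) = p / (p - 1) := by
      rw [hardyFactor, if_pos rfl]
      have hp0 : 0 < p := by linarith
      rw [Real.rpow_sub (by positivity), Real.rpow_one, Real.div_rpow hp0.le hp1.le, neg_div,
        Real.rpow_neg hp1.le]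
      have h1 : 0 < p ^ (1 / p) := by positivity
      have h2 : 0 < (p - 1) ^ (1 / p) := by positivity
      field_simp
    rw [e]
    exact ⟨by positivity, toNNReal_mem_mixedHardyConstants_self hp⟩
  · have hr : 0 < q / p - 1 := by
      rw [sub_pos, one_lt_div (by linarith)]; exact hlt
    have hq0 : 0 < q := by linarith
    have hqr : q = p * (1 + (q / p - 1)) := by field_simp; ring
    have hB : 0 < eulerBeta (1 / (q / p - 1)) ((q - 1) / (q / p - 1)) :=
      eulerBeta_pos (by positivity) (by positivity)
    have hmem := toNNReal_mem_mixedHardyConstants hp hr hqr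
    have e : hardyFactor q p * (q - 1) ^ (-1 / q) =
        (((q / p - 1) / eulerBeta (1 / (q / p - 1)) ((q - 1) / (q / p - 1))) ^ (q / p - 1) /
          (q - 1)) ^ (1 / q) := by
      rw [hardyFactor, if_neg hlt.ne, Real.div_rpow (by positivity) hq1.le,
        ← Real.rpow_mul (by positivity), neg_div, Real.rpow_neg hq1.le, div_eq_mul_inv (_ ^ _),
        show (q / p - 1) * (1 / q) = 1 / p - 1 / q by field_simp]
    rw [e]
    exact ⟨by positivity, hmem⟩

theorem corollary1p4 :
    (∀ (p : ℝ), 1 < p → ∀ f : ℝ → ℝ≥0, AEMeasurable f (volume.restrict (Ici (1 : ℝ))) →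
      ∑' n : ℕ, (((n + 1 : ℕ) : ℝ≥0∞)⁻¹ *
          ∫⁻ t in Ioc (1 : ℝ) ((n + 1 : ℕ) : ℝ), (f t : ℝ≥0∞)) ^ p
        ≤ ENNReal.ofReal ((p / (p - 1)) ^ p) * ∫⁻ x in Ioi (1 : ℝ), (f x : ℝ≥0∞) ^ p) ∧
    (∀ (p q : ℝ), 1 < p → p ≤ q →
      ∃ A : ℝ≥0, IsLeast (mixedHardyConstants p q) A ∧
        (q - 1) ^ (-1 / q) ≤ (A : ℝ) ∧ (A : ℝ) ≤ hardyFactor q p * (q - 1) ^ (-1 / q)) := by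
  refine ⟨fun p hp f hf => hardy_sum_integral hp ?_, fun p q hp hpq => ?_⟩
  · exact (hf.mono_measure (Measure.restrict_mono Ioi_subset_Ici_self le_rfl)).coe_nnreal_ennreal
  · obtain ⟨h0, hmem⟩ := hardyFactor_mul_mem hp hpq
    have hleast := isLeast_sInf_mixedHardyConstants (p := p) (q := q) (by linarith) (by linarith)
      ⟨_, hmem⟩
    refine ⟨_, hleast, le_of_mem_mixedHardyConstants (by linarith) (by linarith) hleast.1, ?_⟩
    have h := NNReal.coe_le_coe.2 (hleast.2 hmem)
    rwa [Real.coe_toNNReal _ h0] at h
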